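/- Let $X$ be the set of sequences $a=(a_1,a_2,\dots)$ of bounded measurable $2\pi$-periodic functions $a_i:\mathbb R\to\mathbb C$ such that, for some $l>0$ (depending on $a$), $\sup_x|a_i(x)|\le l^i$ for all $i\ge 1$. For $a,b\in X$ define $a*b$ and $a^{-1}$ in $X$ by $$(a*b)_i(t)=\begin{cases}2a_i(2t),&0<t\le\pi,\\ 2b_i(2t-2\pi),&\pi<t\le 2\pi,\end{cases}\qquad (a^{-1})_i(t)=-a_i(2\pi-t)\quad(0<t\le 2\pi),$$ extended $2\pi$-periodically. For positive integers $i_1,\dots,i_k$, $k\ge1$, put $$I_{i_1,\dots,i_k}(a)=\int\cdots\int_{0\le s_1\le\cdots\le s_k\le 2\pi}a_{i_k}(s_k)\cdots a_{i_1}(s_1)\,ds_k\cdots ds_1 .$$ Write $a\sim b$ if $I_{i_1,\dots,i_k}(a*b^{-1})=0$ for all $k\ge 1$ and all positive integers $i_1,\dots,i_k$. This is an equivalence relation, and the set $G(X)$ of equivalence classes is a group under $[a]\cdot[b]=[a*b]$, with unit $[0]$ and inverse $[a]^{-1}=[a^{-1}]$. Let $G_c[[r]]$ be the set of complex power series $f(r)=r+\sum_{k\ge1}d_k(f)r^{k+1}$,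 each convergent in some neighbourhood of $0$. It is a group under composition of series, where the product of $f$ and $g$ is taken to be $g\circ f$ (first $f$, then $g$). Give it the weakest topology for which all functions $d_k:G_c[[r]]\to\mathbb C$, $k\ge1$, are continuous. For $a\in X$ consider the equation $\frac{dv}{dx}=\sum_{i\ge1}a_i(x)v^{i+1}$ on $[0,2\pi]$; its solutions are Lipschitz functions $v:[0,2\pi]\to\mathbb C$ satisfying it almost everywhere. The first return map of $a$ is $P(a)(r)=v(2\pi)$, where $v$ is the unique solution with $v(0)=r$, for $r\in\mathbb C$ sufficiently small; it is (the sum of) an element of $G_c[[r]]$. For $n\ge1$ let $$c_n(a)=\sum_{k\ge1}\ \sum_{i_1+\dots+i_k=n}(n-i_1+1)(n-i_1-i_2+1)\cdots(n-i_1-\dots-i_k+1)\,I_{i_1,\dots,i_k}(a),$$ which is the coefficient of $r^{n+1}$ in $P(a)(r)$. **Theorem.** $G_c[[r]]$ is a topological group. There is a group homomorphism $\widehat P:G(X)\to G_c[[r]]$ with $\widehat P([a])=P(a)$ for all $a\in X$. Let $\widehat{\mathcal C}=\ker\widehat P$, $Q(X)=G(X)/\widehat{\mathcal C}$, and let $\pi:G(X)\to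 Q(X)$ be the quotient homomorphism. For every $n\ge1$ there is a function $\overline c_n:Q(X)\to\mathbb C$ with $\overline c_n(\pi([a]))=c_n(a)=d_n(\widehat P([a]))$ for all $a\in X$. Equipped with the weakest topology in which all $\overline c_n$, $n\ge1$, are continuous, $Q(X)$ is a topological group, and there is an isomorphism of topological groups (a group isomorphism that is a homeomorphism) $\overline P:Q(X)\to G_c[[r]]$ such that $\widehat P=\overline P\circ\pi$. -/

import Mathlib

open Filter Topology MeasureTheory

noncomputable section

namespace CenterProblem

/-! ### The coefficient space `X` -/

/-- The length of the circle. -/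
abbrev circ : ℝ := 2 * Real.pi

lemma circ_pos : 0 < circ := Real.two_pi_pos

/-- The space `X`: sequences `(a₁, a₂, …)` of bounded measurable complex functions on the circle,
viewed as `2π`-periodic functions on `ℝ`, with `sup |aᵢ| ≤ l ^ i` for some `l > 0`. -/
structure CoeffSeq where
  toFun : ℕ+ → ℝ → ℂ
  measurable' : ∀ i, Measurable (toFun i)
  periodic' : ∀ i, Function.Periodic (toFun i) circ
  bound' : ∃ l : ℝ, 0 < l ∧ ∀ i x, ‖toFun i x‖ ≤ l ^ (i : ℕ)

namespace CoeffSeq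

instance : CoeFun CoeffSeq (fun _ => ℕ+ → ℝ → ℂ) := ⟨toFun⟩

/-- The zero sequence. -/
instance : Zero CoeffSeq :=
  ⟨{ toFun := fun _ _ => 0
     measurable' := fun _ => measurable_const
     periodic' := fun _ _ => rfl
     bound' := ⟨1, one_pos, fun i x => by simp⟩ }⟩

/-- Concatenation of two functions on the circle: on `(0, π]` it is `2 f(2t)`, on `(π, 2π]` it is
`2 g(2t - 2π)`, and it is extended with period `2π`. -/
def concat (f g : ℝ → ℂ) (t : ℝ) : ℂ :=
  if toIocMod circ_pos 0 t ≤ Real.pi then 2 * f (2 * toIocMod circ_pos 0 t)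
  else 2 * g (2 * toIocMod circ_pos 0 t - circ)

lemma measurable_toIocMod : Measurable (toIocMod circ_pos 0) := by
  have : toIocMod circ_pos 0 = fun t : ℝ => circ - Int.fract ((0 + circ - t) / circ) * circ - 0 := by
    funext t
    rw [toIocMod_eq_sub_fract_mul]
    ring
  rw [this]
  fun_prop

lemma measurable_concat {f g : ℝ → ℂ} (hf : Measurable f) (hg : Measurable g) :
    Measurable (concat f g) := by
  have h := measurable_toIocMod
  refine Measurable.ite (measurableSet_le h measurable_const) ?_ ?_
  · exact (hf.comp (h.const_mul 2)).const_mul 2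
  · exact (hg.comp ((h.const_mul 2).sub_const circ)).const_mul 2

lemma norm_concat_le {f g : ℝ → ℂ} {C : ℝ} (hf : ∀ x, ‖f x‖ ≤ C) (hg : ∀ x, ‖g x‖ ≤ C) (t : ℝ) :
    ‖concat f g t‖ ≤ 2 * C := by
  unfold concat
  split_ifs
  · rw [norm_mul, Complex.norm_ofNat]; gcongr; exact hf _
  · rw [norm_mul, Complex.norm_ofNat]; gcongr; exact hg _

/-- The multiplication `a * b` on `X`. -/
instance : Mul CoeffSeq :=
  ⟨fun a b =>
    { toFun := fun i => concat (a i) (b i)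
      measurable' := fun i => measurable_concat (a.measurable' i) (b.measurable' i)
      periodic' := fun i t => by simp [concat, toIocMod_add_right]
      bound' := by
        obtain ⟨l, hl, ha⟩ := a.bound'
        obtain ⟨m, hm, hb⟩ := b.bound'
        refine ⟨2 * max l m, by positivity, fun i x => ?_⟩
        have h1 : ∀ x, ‖a i x‖ ≤ (max l m) ^ (i : ℕ) := fun x =>
          (ha i x).trans (by gcongr; exact le_max_left _ _)
        have h2 : ∀ x, ‖b i x‖ ≤ (max l m) ^ (i : ℕ) := fun x =>
          (hb i x).trans (by gcongr; exact le_max_right _ _)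
        refine (norm_concat_le h1 h2 x).trans ?_
        rw [mul_pow]
        gcongr
        exact le_self_pow₀ one_le_two i.ne_zero }⟩

/-- The reversed sequence `a⁻¹(t) = -a(2π - t)`. -/
instance : Inv CoeffSeq :=
  ⟨fun a =>
    { toFun := fun i t => -a i (circ - t)
      measurable' := fun i => ((a.measurable' i).comp (measurable_const.sub measurable_id)).neg
      periodic' := fun i t => by
        have := (a.periodic' i) (circ - (t + circ))
        simp only [neg_inj]
        rw [← this]
        congr 1
        ring
      bound' := by
        obtain ⟨l, hl, ha⟩ := a.bound'
        exact ⟨l, hl, fun i x => by simpa using ha i _⟩ }⟩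

lemma mul_apply (a b : CoeffSeq) (i : ℕ+) (t : ℝ) : (a * b) i t = concat (a i) (b i) t := rfl

lemma inv_apply (a : CoeffSeq) (i : ℕ+) (t : ℝ) : a⁻¹ i t = -a i (circ - t) := rfl

end CoeffSeq

/-! ### Iterated integrals -/

/-- The iterated integral
`∫_{x ≤ s₁ ≤ ⋯ ≤ s_k ≤ y} a_{i_k}(s_k) ⋯ a_{i_1}(s₁) ds_k ⋯ ds₁` for the list `[i₁, …, i_k]`. -/
def iterInt (a : CoeffSeq) : List ℕ+ → ℝ → ℝ → ℂ
  | [], _, _ => 1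
  | i :: L, x, y => ∫ s in x..y, a i s * iterInt a L s y

/-- The basic iterated integral `I_{i_1, …, i_k}` on `X`. -/
def basicInt (a : CoeffSeq) (L : List ℕ+) : ℂ := iterInt a L 0 circ

/-- The universal centers: all basic iterated integrals of positive order vanish. -/
def universalCenters : Set CoeffSeq := {a | ∀ L : List ℕ+, L ≠ [] → basicInt a L = 0}

/-- The relation `a ∼ b` on `X`. -/
def equivRel (a b : CoeffSeq) : Prop := a * b⁻¹ ∈ universalCenters

/-! ### `∼` is an equivalence relation compatible with the product -/

/-- Sum of `f L₁ * g L₂` over all splittings of a list as `L₁ ++ L₂`. -/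
def conv (f g : List ℕ+ → ℂ) : List ℕ+ → ℂ
  | [] => f [] * g []
  | i :: L => f [] * g (i :: L) + conv (fun M => f (i :: M)) g L

lemma conv_smul_add (c : ℂ) (f f' g : List ℕ+ → ℂ) (L : List ℕ+) :
    conv (fun M => c * f M + f' M) g L = c * conv f g L + conv f' g L := by
  induction L generalizing f f' with
  | nil => simp only [conv]; ring
  | cons i L ih => simp only [conv]; rw [ih]; ring

lemma conv_assoc (f g h : List ℕ+ → ℂ) (L : List ℕ+) :
    conv (conv f g) h L = conv f (conv g h) L := by
  induction L generalizing f with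
  | nil => simp only [conv]; ring
  | cons i L ih =>
    have : (fun M => conv f g (i :: M)) =
        fun M => f [] * (fun M => g (i :: M)) M + conv (fun M => f (i :: M)) g M := rfl
    conv_lhs => rw [conv, this, conv_smul_add, ih]
    simp only [conv]; ring

/-- The family with value `1` on the empty list and `0` elsewhere. -/
def convOne : List ℕ+ → ℂ
  | [] => 1
  | _ :: _ => 0

lemma zero_conv (g : List ℕ+ → ℂ) (L : List ℕ+) : conv (fun _ => 0) g L = 0 := by
  induction L with
  | nil => simp [conv]
  | cons i L ih => simp [conv, ih]

lemma one_conv (g : List ℕ+ → ℂ) : conv convOne g = g := by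
  funext L
  cases L with
  | nil => simp [conv, convOne]
  | cons i L =>
    have : (fun M => convOne (i :: M)) = fun _ => 0 := rfl
    rw [conv, this, zero_conv]; simp [convOne]

lemma conv_one (f : List ℕ+ → ℂ) : conv f convOne = f := by
  funext L
  induction L generalizing f with
  | nil => simp [conv, convOne]
  | cons i L ih => rw [conv, ih]; simp [convOne]

lemma intervalIntegrable_mul (a : CoeffSeq) (i : ℕ+) {f : ℝ → ℂ} (hf : Continuous f) (x y : ℝ) :
    IntervalIntegrable (fun s => a i s * f s) volume x y := by
  obtain ⟨l, -, ha⟩ := a.bound'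
  have h1 : IntervalIntegrable (a i) volume x y := by
    rw [intervalIntegrable_iff]
    exact Measure.integrableOn_of_bounded (M := l ^ (i : ℕ)) (by simp)
      (a.measurable' i).aestronglyMeasurable (Eventually.of_forall fun s => ha i s)
  exact h1.mul_continuousOn hf.continuousOn

lemma continuous_iterInt (a : CoeffSeq) (L : List ℕ+) (y : ℝ) :
    Continuous fun x => iterInt a L x y := by
  induction L with
  | nil => simpa only [iterInt] using continuous_const
  | cons i L ih =>
    simp only [iterInt]
    have : (fun x => ∫ s in x..y, a i s * iterInt a L s y) =
        fun x => -∫ s in y..x, a i s * iterInt a L s y := by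
      funext x; rw [intervalIntegral.integral_symm]
    rw [this]
    exact (intervalIntegral.continuous_primitive
      (fun p q => intervalIntegrable_mul a i ih p q) y).neg

/-- The iterated integrals over `[x, z]` split at any point `y`. -/
lemma iterInt_split (a : CoeffSeq) (x y z : ℝ) (L : List ℕ+) :
    iterInt a L x z = conv (fun M => iterInt a M x y) (fun M => iterInt a M y z) L := by
  induction L generalizing x with
  | nil => simp [conv, iterInt]
  | cons i L ih =>
    have key : ∀ (L : List ℕ+) (F : ℝ → List ℕ+ → ℂ) (g : List ℕ+ → ℂ),
        (∀ M, Continuous fun s => F s M) →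
        (Continuous fun s => conv (F s) g L) ∧
        (∫ s in x..y, a i s * conv (F s) g L) =
          conv (fun M => ∫ s in x..y, a i s * F s M) g L := by
      intro L
      induction L with
      | nil =>
        intro F g hF
        simp only [conv]
        refine ⟨(hF []).mul continuous_const, ?_⟩
        rw [← intervalIntegral.integral_mul_const]
        simp only [mul_assoc]
      | cons j L ihL =>
        intro F g hF
        obtain ⟨h1, h2⟩ := ihL (fun s M => F s (j :: M)) g (fun M => hF _)
        simp only [conv]
        refine ⟨((hF []).mul continuous_const).add h1, ?_⟩
        rw [← h2, ← intervalIntegral.integral_mul_const, ← intervalIntegral.integral_add]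
        · simp only [mul_add, mul_assoc]
        · exact (intervalIntegrable_mul a i (hF []) x y).mul_const _
        · exact intervalIntegrable_mul a i h1 x y
    have e := (key L (fun s M => iterInt a M s y) (fun M => iterInt a M y z)
      (fun M => continuous_iterInt a M y)).2
    rw [conv]
    simp only [iterInt] at e ⊢
    rw [← e, ← intervalIntegral.integral_add_adjacent_intervals
      (intervalIntegrable_mul a i (continuous_iterInt a L z) x y)
      (intervalIntegrable_mul a i (continuous_iterInt a L z) y z), add_comm, one_mul]
    congr 1
    refine intervalIntegral.integral_congr fun s _ => ?_
    rw [ih]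

lemma iterInt_self (a : CoeffSeq) (x : ℝ) : (fun M => iterInt a M x x) = convOne := by
  funext L
  cases L <;> simp [iterInt, convOne]

/-- Behaviour of the iterated integrals under an affine change of variable. -/
lemma iterInt_affine (a b : CoeffSeq) (c d p q : ℝ) (hc : c ≠ 0)
    (h : ∀ i s, s ∈ Set.uIoc p q → a i s = c * b i (c * s + d)) (L : List ℕ+) :
    ∀ x ∈ Set.uIcc p q, iterInt a L x q = iterInt b L (c * x + d) (c * q + d) := by
  induction L with
  | nil => intro x _; rfl
  | cons i L ih =>
    intro x hx
    simp only [iterInt]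
    have hsub : Set.uIoc x q ⊆ Set.uIoc p q :=
      Set.uIoc_subset_uIoc_of_uIcc_subset_uIcc (Set.uIcc_subset_uIcc hx Set.right_mem_uIcc)
    have e : (∫ s in x..q, a i s * iterInt a L s q) =
        ∫ s in x..q, (c : ℂ) * (fun u => b i u * iterInt b L u (c * q + d)) (c * s + d) := by
      refine intervalIntegral.integral_congr_ae (Eventually.of_forall fun s hs => ?_)
      rw [h i s (hsub hs), ih s (Set.uIoc_subset_uIcc (hsub hs))]
      simp only [mul_assoc]
    rw [e, intervalIntegral.integral_const_mul,
      intervalIntegral.integral_comp_mul_add (fun u => b i u * iterInt b L u (c * q + d)) hc d,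
      Complex.real_smul, ← mul_assoc, Complex.ofReal_inv,
      mul_inv_cancel₀ (Complex.ofReal_ne_zero.mpr hc), one_mul]

lemma toIocMod_eq_self_of_mem {s : ℝ} (hs : 0 < s) (hs' : s ≤ circ) :
    toIocMod circ_pos 0 s = s :=
  (toIocMod_eq_self circ_pos).mpr ⟨hs, by simpa using hs'⟩

lemma basicInt_mul (a b : CoeffSeq) : basicInt (a * b) = conv (basicInt a) (basicInt b) := by
  funext L
  have hpi := Real.pi_pos
  rw [basicInt, iterInt_split _ 0 Real.pi circ]
  congr 1
  · funext M
    have := iterInt_affine (a * b) a 2 0 0 Real.pi two_ne_zero (fun i s hs => ?_) M 0 Set.left_mem_uIcc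
    · simpa [basicInt] using this
    · rw [Set.uIoc_of_le hpi.le] at hs
      have hs2 : s ≤ circ := by have := hs.2; unfold circ; linarith
      rw [CoeffSeq.mul_apply, CoeffSeq.concat, toIocMod_eq_self_of_mem hs.1 hs2, if_pos hs.2]
      simp
  · funext M
    have := iterInt_affine (a * b) b 2 (-circ) Real.pi circ two_ne_zero (fun i s hs => ?_) M
      Real.pi Set.left_mem_uIcc
    · rw [this, basicInt]; congr 1 <;> (unfold circ; ring)
    · rw [Set.uIoc_of_le (by unfold circ; linarith)] at hs
      rw [CoeffSeq.mul_apply, CoeffSeq.concat, toIocMod_eq_self_of_mem (hpi.trans hs.1) hs.2,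
        if_neg (not_le.mpr hs.1), sub_eq_add_neg]
      simp

lemma basicInt_inv (a : CoeffSeq) (L : List ℕ+) : basicInt a⁻¹ L = iterInt a L circ 0 := by
  have := iterInt_affine a⁻¹ a (-1) circ 0 circ (by norm_num) (fun i s _ => ?_) L 0 Set.left_mem_uIcc
  · rw [basicInt, this]; congr 1 <;> ring
  · rw [CoeffSeq.inv_apply]
    rw [show (-1 : ℝ) * s + circ = circ - s by ring]
    push_cast
    ring

lemma basicInt_mul_inv (a : CoeffSeq) : conv (basicInt a) (basicInt a⁻¹) = convOne := by
  rw [← iterInt_self a 0]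
  funext L
  rw [iterInt_split a 0 circ 0]
  congr 1
  funext M
  exact basicInt_inv a M

lemma basicInt_inv_mul (a : CoeffSeq) : conv (basicInt a⁻¹) (basicInt a) = convOne := by
  rw [← iterInt_self a circ]
  funext L
  rw [iterInt_split a circ 0 circ]
  congr 1
  funext M
  exact basicInt_inv a M

lemma basicInt_zero : basicInt 0 = convOne := by
  funext L
  cases L with
  | nil => rfl
  | cons i L =>
    have : ∀ s, (0 : CoeffSeq) i s = 0 := fun _ => rfl
    simp [basicInt, iterInt, convOne, this]

lemma mem_universalCenters_iff (a : CoeffSeq) : a ∈ universalCenters ↔ basicInt a = convOne := by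
  constructor
  · intro h
    funext L
    cases L with
    | nil => rfl
    | cons i L => exact h _ (List.cons_ne_nil _ _)
  · intro h L hL
    rw [h]
    cases L with
    | nil => exact absurd rfl hL
    | cons i L => rfl

/-- Two sequences are equivalent exactly when all their iterated integrals agree. -/
lemma equivRel_iff (a b : CoeffSeq) : equivRel a b ↔ basicInt a = basicInt b := by
  rw [equivRel, mem_universalCenters_iff, basicInt_mul]
  constructor
  · intro h
    have := congrArg (fun f => conv f (basicInt b)) h
    simp only [one_conv] at this
    rwa [funext (conv_assoc _ _ _), basicInt_inv_mul, conv_one] at this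
  · intro h
    rw [h, basicInt_mul_inv]

/-! ### The group `G(X)` -/

/-- The relation `∼` as a setoid. -/
def equivSetoid : Setoid CoeffSeq where
  r := equivRel
  iseqv :=
    { refl := fun a => (equivRel_iff a a).mpr rfl
      symm := fun h => (equivRel_iff _ _).mpr ((equivRel_iff _ _).mp h).symm
      trans := fun h h' =>
        (equivRel_iff _ _).mpr (((equivRel_iff _ _).mp h).trans ((equivRel_iff _ _).mp h')) }

/-- The set `G(X)` of equivalence classes. -/
def GX : Type := Quotient equivSetoid

/-- The class `[a]` of `a`. -/
def GX.mk (a : CoeffSeq) : GX := Quotient.mk equivSetoid a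

lemma GX.mk_eq_iff (a b : CoeffSeq) : GX.mk a = GX.mk b ↔ basicInt a = basicInt b :=
  Quotient.eq.trans (equivRel_iff a b)

/-- The group `G(X)`, with `[a] · [b] = [a * b]`, unit `[0]` and `[a]⁻¹ = [a⁻¹]`. -/
instance : Group GX where
  mul := Quotient.map₂ (· * ·) (by
    intro a a' h b b' h'
    refine (equivRel_iff _ _).mpr ?_
    simp only [basicInt_mul]
    rw [(equivRel_iff _ _).mp h, (equivRel_iff _ _).mp h'])
  one := GX.mk 0
  inv := Quotient.map (·⁻¹) (by
    intro a b h
    have h := (equivRel_iff _ _).mp h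
    refine (equivRel_iff _ _).mpr ?_
    calc basicInt a⁻¹ = conv (basicInt a⁻¹) (conv (basicInt b) (basicInt b⁻¹)) := by
          rw [basicInt_mul_inv, conv_one]
      _ = conv (conv (basicInt a⁻¹) (basicInt a)) (basicInt b⁻¹) := by
          rw [funext (conv_assoc _ _ _), h]
      _ = basicInt b⁻¹ := by rw [basicInt_inv_mul, one_conv])
  mul_assoc := by
    rintro ⟨a⟩ ⟨b⟩ ⟨c⟩
    refine (GX.mk_eq_iff (a * b * c) (a * (b * c))).mpr ?_
    simp only [basicInt_mul]
    exact funext (conv_assoc _ _ _)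
  one_mul := by
    rintro ⟨a⟩
    refine (GX.mk_eq_iff (0 * a) a).mpr ?_
    rw [basicInt_mul, basicInt_zero, one_conv]
  mul_one := by
    rintro ⟨a⟩
    refine (GX.mk_eq_iff (a * 0) a).mpr ?_
    rw [basicInt_mul, basicInt_zero, conv_one]
  inv_mul_cancel := by
    rintro ⟨a⟩
    refine (GX.mk_eq_iff (a⁻¹ * a) 0).mpr ?_
    rw [basicInt_mul, basicInt_zero, basicInt_inv_mul]

lemma GX.mk_mul (a b : CoeffSeq) : GX.mk (a * b) = GX.mk a * GX.mk b := rfl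

/-! ### The group `G_c[[r]]` -/

/-- A complex power series is convergent if it converges in some neighbourhood of `0`. -/
def IsConvergent (p : PowerSeries ℂ) : Prop :=
  ∀ᶠ z in 𝓝 (0 : ℂ), Summable fun n => PowerSeries.coeff n p * z ^ n

lemma isConvergent_iff (p : PowerSeries ℂ) :
    IsConvergent p ↔ ∃ ρ : ℝ, 0 < ρ ∧ Summable fun n => ‖PowerSeries.coeff n p‖ * ρ ^ n := by
  constructor
  · intro h
    obtain ⟨ε, hε, h⟩ := Metric.eventually_nhds_iff.mp h
    refine ⟨ε / 2, by positivity, ?_⟩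
    have := (h (y := ((ε / 2 : ℝ) : ℂ)) (by
      rw [dist_zero_right, Complex.norm_real, Real.norm_of_nonneg (by positivity)]; linarith)).norm
    refine this.congr fun n => ?_
    rw [norm_mul, norm_pow, Complex.norm_real, Real.norm_of_nonneg (by positivity)]
  · rintro ⟨ρ, hρ, h⟩
    filter_upwards [Metric.ball_mem_nhds (0 : ℂ) hρ] with z hz
    refine Summable.of_norm_bounded h fun n => ?_
    rw [norm_mul, norm_pow]
    gcongr
    exact (mem_ball_zero_iff.mp hz).le

lemma pow_bound (p : PowerSeries ℂ) {ρ : ℝ} (hρ : 0 ≤ ρ)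
    (h : Summable fun n => ‖PowerSeries.coeff n p‖ * ρ ^ n) (d : ℕ) :
    (Summable fun n => ‖PowerSeries.coeff n (p ^ d)‖ * ρ ^ n) ∧
      (∑' n, ‖PowerSeries.coeff n (p ^ d)‖ * ρ ^ n) ≤
        (∑' n, ‖PowerSeries.coeff n p‖ * ρ ^ n) ^ d := by
  induction d with
  | zero =>
    have e : ∀ n, n ≠ 0 → ‖PowerSeries.coeff n (p ^ 0)‖ * ρ ^ n = 0 := fun n hn => by
      simp [PowerSeries.coeff_one, hn]
    have := hasSum_single 0 e
    refine ⟨this.summable, ?_⟩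
    rw [this.tsum_eq]
    simp
  | succ d ih =>
    obtain ⟨h1, h2⟩ := ih
    have n1 : Summable fun n => ‖‖PowerSeries.coeff n (p ^ d)‖ * ρ ^ n‖ := h1.norm
    have n2 : Summable fun n => ‖‖PowerSeries.coeff n p‖ * ρ ^ n‖ := h.norm
    have s := (summable_norm_sum_mul_antidiagonal_of_summable_norm n1 n2).of_norm
    have e := tsum_mul_tsum_eq_tsum_sum_antidiagonal_of_summable_norm n1 n2
    have le : ∀ n, ‖PowerSeries.coeff n (p ^ (d + 1))‖ * ρ ^ n ≤
        ∑ kl ∈ Finset.HasAntidiagonal.antidiagonal n, ‖PowerSeries.coeff kl.1 (p ^ d)‖ * ρ ^ kl.1 *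
          (‖PowerSeries.coeff kl.2 p‖ * ρ ^ kl.2) := by
      intro n
      rw [pow_succ, PowerSeries.coeff_mul]
      refine (mul_le_mul_of_nonneg_right (norm_sum_le _ _) (by positivity)).trans ?_
      rw [Finset.sum_mul]
      refine Finset.sum_le_sum fun kl hkl => ?_
      rw [← Finset.HasAntidiagonal.mem_antidiagonal.mp hkl, norm_mul, pow_add]
      exact le_of_eq (by ring)
    have s' := Summable.of_nonneg_of_le (fun n => by positivity) le s
    refine ⟨s', (s'.tsum_le_tsum le s).trans ?_⟩
    rw [← e, pow_succ]
    exact mul_le_mul_of_nonneg_right h2 (tsum_nonneg fun n => by positivity)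

lemma pow_hasSum (p : PowerSeries ℂ) {ρ : ℝ} (hρ : 0 ≤ ρ)
    (h : Summable fun n => ‖PowerSeries.coeff n p‖ * ρ ^ n) {z : ℂ} (hz : ‖z‖ ≤ ρ) (d : ℕ) :
    HasSum (fun n => PowerSeries.coeff n (p ^ d) * z ^ n)
      ((∑' n, PowerSeries.coeff n p * z ^ n) ^ d) := by
  have ns : ∀ d, Summable fun n => ‖PowerSeries.coeff n (p ^ d) * z ^ n‖ := fun d =>
    Summable.of_nonneg_of_le (fun n => norm_nonneg _)
      (fun n => by rw [norm_mul, norm_pow]; gcongr) (pow_bound p hρ h d).1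
  have e : (∑' n, PowerSeries.coeff n (p ^ d) * z ^ n) =
      (∑' n, PowerSeries.coeff n p * z ^ n) ^ d := by
    induction d with
    | zero =>
      rw [tsum_eq_single 0 (fun n hn => by simp [PowerSeries.coeff_one, hn])]
      simp
    | succ d ih =>
      rw [pow_succ (∑' n, PowerSeries.coeff n p * z ^ n), ← ih, tsum_mul_tsum_eq_tsum_sum_antidiagonal_of_summable_norm (ns d)
        (by simpa using ns 1)]
      refine tsum_congr fun n => ?_
      rw [pow_succ, PowerSeries.coeff_mul, Finset.sum_mul]
      refine Finset.sum_congr rfl fun kl hkl => ?_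
      rw [← Finset.HasAntidiagonal.mem_antidiagonal.mp hkl, pow_add]
      ring
  rw [← e]
  exact (ns d).of_norm.hasSum

/-- Formal substitution of convergent series converges, to the composition of the sums. -/
lemma subst_main (f g : PowerSeries ℂ) (hg0 : PowerSeries.constantCoeff g = 0)
    (hf : IsConvergent f) (hg : IsConvergent g) :
    ∃ ρ : ℝ, 0 < ρ ∧ (Summable fun n => ‖PowerSeries.coeff n (f.subst g)‖ * ρ ^ n) ∧
      ∀ z : ℂ, ‖z‖ ≤ ρ → HasSum (fun n => PowerSeries.coeff n (f.subst g) * z ^ n)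
        (∑' d, PowerSeries.coeff d f * (∑' n, PowerSeries.coeff n g * z ^ n) ^ d) := by
  have hs : PowerSeries.HasSubst g := PowerSeries.HasSubst.of_constantCoeff_zero' hg0
  obtain ⟨σ, hσ, hf⟩ := (isConvergent_iff f).mp hf
  obtain ⟨ρ₀, hρ₀, hg⟩ := (isConvergent_iff g).mp hg
  set S := ∑' n, ‖PowerSeries.coeff n g‖ * ρ₀ ^ n with hS
  have hS0 : 0 ≤ S := tsum_nonneg fun n => by positivity
  -- shrink the radius by a factor `t`, so that the majorant of `g` is at most `σ`
  set t : ℝ := min 1 (σ / (S + 1)) with ht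
  have ht0 : 0 < t := lt_min one_pos (by positivity)
  have ht1 : t ≤ 1 := min_le_left _ _
  have hle : ∀ n, ‖PowerSeries.coeff n g‖ * (t * ρ₀) ^ n ≤
      t * (‖PowerSeries.coeff n g‖ * ρ₀ ^ n) := by
    intro n
    cases n with
    | zero =>
      rw [PowerSeries.coeff_zero_eq_constantCoeff_apply, hg0]; simp
    | succ n =>
      rw [mul_pow, mul_left_comm]
      have : t ^ (n + 1) ≤ t := pow_le_of_le_one ht0.le ht1 (Nat.succ_ne_zero n)
      gcongr
  set ρ := t * ρ₀ with hρ
  have hρ0 : 0 < ρ := by positivity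
  have hgρ : Summable fun n => ‖PowerSeries.coeff n g‖ * ρ ^ n :=
    Summable.of_nonneg_of_le (fun n => by positivity) hle (hg.mul_left t)
  have hT : (∑' n, ‖PowerSeries.coeff n g‖ * ρ ^ n) ≤ σ := by
    refine (hgρ.tsum_le_tsum hle (hg.mul_left t)).trans ?_
    rw [tsum_mul_left, ← hS]
    calc t * S ≤ σ / (S + 1) * (S + 1) := by
          gcongr
          · exact min_le_right _ _
          · linarith
      _ = σ := div_mul_cancel₀ _ (by positivity)
  clear_value ρ t S
  -- the double family is summable
  have hdouble : Summable fun x : ℕ × ℕ =>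
      ‖PowerSeries.coeff x.1 f‖ * (‖PowerSeries.coeff x.2 (g ^ x.1)‖ * ρ ^ x.2) := by
    have h0 : 0 ≤ fun x : ℕ × ℕ =>
        ‖PowerSeries.coeff x.1 f‖ * (‖PowerSeries.coeff x.2 (g ^ x.1)‖ * ρ ^ x.2) := fun x =>
      mul_nonneg (norm_nonneg _) (mul_nonneg (norm_nonneg _) (pow_nonneg hρ0.le _))
    refine (summable_prod_of_nonneg h0).mpr ⟨fun d => ?_, ?_⟩
    · exact Summable.mul_left ‖PowerSeries.coeff d f‖ (pow_bound g hρ0.le hgρ d).1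
    refine Summable.of_nonneg_of_le (fun d => tsum_nonneg fun n => by positivity) (fun d => ?_) hf
    simp only
    rw [tsum_mul_left]
    gcongr
    refine (pow_bound g hρ0.le hgρ d).2.trans ?_
    gcongr
  have hcoeff : ∀ n, HasSum (fun d => PowerSeries.coeff d f * PowerSeries.coeff n (g ^ d))
      (PowerSeries.coeff n (f.subst g)) := by
    intro n
    rw [PowerSeries.coeff_subst' hs]
    have fin := PowerSeries.coeff_subst_finite' hs f n
    simp only [smul_eq_mul] at fin ⊢
    rw [finsum_eq_sum _ fin]
    refine hasSum_sum_of_ne_finset_zero fun d hd => ?_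
    exact by_contra fun h => hd (fin.mem_toFinset.mpr h)
  refine ⟨ρ, hρ0, ?_, fun z hz => ?_⟩
  · have hsw := (Equiv.prodComm ℕ ℕ).summable_iff.mpr hdouble
    have h1 := hsw.prod
    refine Summable.of_nonneg_of_le (fun n => by positivity) (fun n => ?_) h1
    have h2 := hsw.prod_factor n
    have h3 : Summable fun d => ‖PowerSeries.coeff d f * PowerSeries.coeff n (g ^ d) * ρ ^ n‖ := by
      refine h2.congr fun d => ?_
      simp [abs_of_pos hρ0, mul_assoc]
    have h4 := norm_tsum_le_tsum_norm h3
    rw [((hcoeff n).mul_right ((ρ : ℂ) ^ n)).tsum_eq] at h4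
    rw [norm_mul, norm_pow, Complex.norm_real, Real.norm_of_nonneg hρ0.le] at h4
    refine h4.trans (le_of_eq (tsum_congr fun d => ?_))
    simp [abs_of_pos hρ0, mul_assoc]
  · have hsum : Summable fun x : ℕ × ℕ =>
        PowerSeries.coeff x.1 f * (PowerSeries.coeff x.2 (g ^ x.1) * z ^ x.2) := by
      refine Summable.of_norm_bounded hdouble fun x => ?_
      rw [norm_mul, norm_mul, norm_pow]
      gcongr
    have hA : HasSum (fun x : ℕ × ℕ =>
        PowerSeries.coeff x.1 f * (PowerSeries.coeff x.2 (g ^ x.1) * z ^ x.2))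
        (∑' d, PowerSeries.coeff d f * (∑' n, PowerSeries.coeff n g * z ^ n) ^ d) := by
      have h1 := hsum.hasSum
      have h2 := h1.prod_fiberwise fun d =>
        HasSum.mul_left (PowerSeries.coeff d f) (pow_hasSum g hρ0.le hgρ hz d)
      rw [h2.tsum_eq]
      exact h1
    have hB := (Equiv.prodComm ℕ ℕ).hasSum_iff.mpr hA
    refine hB.prod_fiberwise fun n => ?_
    have := (hcoeff n).mul_right (z ^ n)
    simpa [mul_assoc] using this

lemma isConvergent_subst {f g : PowerSeries ℂ} (hg0 : PowerSeries.constantCoeff g = 0)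
    (hf : IsConvergent f) (hg : IsConvergent g) : IsConvergent (f.subst g) := by
  obtain ⟨ρ, hρ, h, -⟩ := subst_main f g hg0 hf hg
  exact (isConvergent_iff _).mpr ⟨ρ, hρ, h⟩

/-- The sum of a convergent power series, as a function. -/
def psum (p : PowerSeries ℂ) (z : ℂ) : ℂ := ∑' n, PowerSeries.coeff n p * z ^ n

lemma hasFPowerSeriesAt_psum {p : PowerSeries ℂ} (hp : IsConvergent p) :
    HasFPowerSeriesAt (psum p)
      (FormalMultilinearSeries.ofScalars ℂ fun n => PowerSeries.coeff n p) 0 := by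
  rw [hasFPowerSeriesAt_iff]
  filter_upwards [hp] with z hz
  simp only [FormalMultilinearSeries.coeff_ofScalars, zero_add, smul_eq_mul]
  simpa [psum, mul_comm] using hz.hasSum

lemma eq_of_psum_eventuallyEq {p q : PowerSeries ℂ} (hp : IsConvergent p) (hq : IsConvergent q)
    (h : psum p =ᶠ[𝓝 0] psum q) : p = q := by
  have := (hasFPowerSeriesAt_psum hp).eq_formalMultilinearSeries
    ((hasFPowerSeriesAt_psum hq).congr h.symm)
  ext n
  have := congrArg (fun r => FormalMultilinearSeries.coeff r n) this
  simpa [FormalMultilinearSeries.coeff_ofScalars] using this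

lemma psum_X (z : ℂ) : psum PowerSeries.X z = z := by
  rw [psum, tsum_eq_single 1 (fun n hn => by simp [PowerSeries.coeff_X, hn])]
  simp

lemma isConvergent_X : IsConvergent PowerSeries.X :=
  Eventually.of_forall fun z => (hasSum_single 1 (fun n hn => by
    simp [PowerSeries.coeff_X, hn])).summable

/-- The formal inverse (under substitution) of a convergent series is convergent. -/
lemma isConvergent_substInv {f : PowerSeries ℂ} (hf0 : PowerSeries.constantCoeff f = 0)
    (hf1 : IsUnit (PowerSeries.coeff 1 f)) (hf : IsConvergent f) :
    IsConvergent (f.substInvOfIsUnit hf1) := by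
  have hF := hasFPowerSeriesAt_psum hf
  have hd : deriv (psum f) 0 ≠ 0 := by
    rw [hF.deriv]
    simpa using hf1.ne_zero
  have hF0 : psum f 0 = 0 := by
    rw [psum, tsum_eq_single 0 (fun n hn => by simp [hn])]
    simpa using hf0
  have hG := hF.analyticAt.analyticAt_localInverse hd
  set G := hF.analyticAt.hasStrictDerivAt.localInverse _ _ _ hd with hGdef
  have hG0 : G 0 = 0 := by
    have : G (psum f 0) = 0 := HasStrictFDerivAt.localInverse_apply_image ..
    rwa [hF0] at this
  have hFG : ∀ᶠ z in 𝓝 (0 : ℂ), psum f (G z) = z := by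
    have := HasStrictDerivAt.eventually_right_inverse hF.analyticAt.hasStrictDerivAt hd
    rwa [hF0] at this
  rw [hF0] at hG
  obtain ⟨q, hq⟩ := hG
  -- the Taylor series of the local inverse
  set g : PowerSeries ℂ := PowerSeries.mk q.coeff with hg
  have hgsum : ∀ᶠ z in 𝓝 (0 : ℂ), HasSum (fun n => PowerSeries.coeff n g * z ^ n) (G z) := by
    have := hasFPowerSeriesAt_iff.mp hq
    simpa [hg, mul_comm] using this
  have hgc : IsConvergent g := hgsum.mono fun z hz => hz.summable
  have hg0 : PowerSeries.constantCoeff g = 0 := by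
    have := hgsum.self_of_nhds
    rw [hG0] at this
    have h2 := hasSum_single (f := fun n => PowerSeries.coeff n g * (0 : ℂ) ^ n) 0
      (fun n hn => by simp [hn])
    simpa using h2.unique this
  have hX : IsConvergent (PowerSeries.X : PowerSeries ℂ) := isConvergent_X
  have e : f.subst g = PowerSeries.X := by
    refine eq_of_psum_eventuallyEq (isConvergent_subst hg0 hf hgc) hX ?_
    obtain ⟨ρ, hρ, -, h⟩ := subst_main f g hg0 hf hgc
    filter_upwards [Metric.ball_mem_nhds (0 : ℂ) hρ, hgsum, hFG] with z hz h1 h2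
    have h3 := (h z (mem_ball_zero_iff.mp hz).le).tsum_eq
    rw [h1.tsum_eq] at h3
    rw [psum_X, psum, h3]
    exact h2
  have hs : PowerSeries.HasSubst g := PowerSeries.HasSubst.of_constantCoeff_zero' hg0
  have hsf : PowerSeries.HasSubst f := PowerSeries.HasSubst.of_constantCoeff_zero' hf0
  have : f.substInvOfIsUnit hf1 = g := by
    have h1 := PowerSeries.subst_comp_subst_apply hsf hs (f.substInvOfIsUnit hf1)
    rw [PowerSeries.subst_substInvOfIsUnit_left f hf0 hf1, PowerSeries.subst_X hs, e,
      PowerSeries.X_subst] at h1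
    exact h1.symm
  rw [this]
  exact hgc

/-- The set `G_c[[r]]` of complex power series `r + ∑_{k ≥ 1} d_k r^{k+1}`, each convergent in some
neighbourhood of `0`. -/
@[ext]
structure Gc where
  series : PowerSeries ℂ
  coeff_zero' : PowerSeries.coeff 0 series = 0
  coeff_one' : PowerSeries.coeff 1 series = 1
  convergent' : IsConvergent series

namespace Gc

lemma constantCoeff_eq (f : Gc) : PowerSeries.constantCoeff f.series = 0 := by
  rw [← PowerSeries.coeff_zero_eq_constantCoeff_apply]; exact f.coeff_zero'

lemma hasSubst (f : Gc) : PowerSeries.HasSubst f.series :=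
  PowerSeries.HasSubst.of_constantCoeff_zero' f.constantCoeff_eq

lemma isUnit_coeff_one (f : Gc) : IsUnit (PowerSeries.coeff 1 f.series) := by
  rw [f.coeff_one']; exact isUnit_one

/-- The composition `f ∘ g` of series, that is `f(g(r))`. -/
def comp (f g : Gc) : Gc where
  series := f.series.subst g.series
  coeff_zero' := by
    rw [PowerSeries.coeff_zero_eq_constantCoeff_apply]
    exact PowerSeries.constantCoeff_subst_eq_zero g.constantCoeff_eq _ f.constantCoeff_eq
  coeff_one' := by
    rw [PowerSeries.coeff_subst' g.hasSubst, finsum_eq_single _ 1]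
    · simp [f.coeff_one', g.coeff_one']
    · intro d hd
      rcases Nat.lt_or_ge d 1 with h | h
      · interval_cases d; simp [f.constantCoeff_eq]
      · have h1 : (1 : ℕ) < d := lt_of_le_of_ne h (Ne.symm hd)
        have : PowerSeries.coeff 1 (g.series ^ d) = 0 := by
          apply PowerSeries.coeff_of_lt_order
          have := PowerSeries.le_order_pow_of_constantCoeff_eq_zero d g.constantCoeff_eq
          exact lt_of_lt_of_le (by exact_mod_cast h1) this
        rw [this, smul_zero]
  convergent' := isConvergent_subst g.constantCoeff_eq f.convergent' g.convergent'

/-- The series `r`. -/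
def id : Gc where
  series := PowerSeries.X
  coeff_zero' := by simp
  coeff_one' := by simp
  convergent' := isConvergent_X

/-- The compositional inverse of a series. -/
def inverse (f : Gc) : Gc where
  series := f.series.substInvOfIsUnit f.isUnit_coeff_one
  coeff_zero' := by simp
  coeff_one' := by
    have h : f.isUnit_coeff_one.unit = 1 := Units.ext f.coeff_one'
    rw [PowerSeries.coeff_one_substInvOfIsUnit, h]
    simp
  convergent' := isConvergent_substInv f.constantCoeff_eq f.isUnit_coeff_one f.convergent'

/-- The group `G_c[[r]]`. The product `f * g` is the composition "first `f`, then `g`", i.e.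
`g ∘ f`, in accordance with the identity `P(a * b) = P(b) ∘ P(a)` for first return maps. -/
instance : Group Gc where
  mul f g := g.comp f
  one := id
  inv := inverse
  mul_assoc f g h := Gc.ext
    (PowerSeries.subst_comp_subst_apply g.hasSubst f.hasSubst h.series).symm
  one_mul f := Gc.ext (PowerSeries.X_subst f.series)
  mul_one f := Gc.ext (PowerSeries.subst_X f.hasSubst)
  inv_mul_cancel f := Gc.ext
    (PowerSeries.subst_substInvOfIsUnit_right f.series f.constantCoeff_eq f.isUnit_coeff_one)

lemma mul_eq_comp (f g : Gc) : f * g = g.comp f := rfl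

/-- The coefficient function `d_k`: the coefficient of `r^{k+1}`. -/
def d (k : ℕ+) (f : Gc) : ℂ := PowerSeries.coeff ((k : ℕ) + 1) f.series

/-- The topology `τ'` on `G_c[[r]]`: the weakest one in which all `d_k` are continuous. -/
instance : TopologicalSpace Gc :=
  ⨅ k : ℕ+, TopologicalSpace.induced (d k) inferInstance

end Gc

/-! ### First return maps -/

/-- `v` is a (generalized) solution on `[0, 2π]` of `dv/dx = ∑_{i ≥ 1} a_i(x) v^{i+1}`: a Lipschitz
function for which the equation holds (with convergent right-hand side) almost everywhere. -/
structure IsLipschitzSolution (a : CoeffSeq) (v : ℝ → ℂ) : Prop where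
  lipschitz : ∃ K, LipschitzOnWith K v (Set.Icc 0 circ)
  ode : ∀ᵐ x ∂(volume.restrict (Set.Icc 0 circ)),
    ∃ s : ℂ, HasSum (fun i : ℕ+ => a i x * v x ^ ((i : ℕ) + 1)) s ∧ HasDerivAt v s x

/-- `f` is the first return map `P(a)`: for all sufficiently small `r`, the equation has a Lipschitz
solution `v` with `v(0) = r`, and every such solution satisfies `v(2π) = f(r)`. Since the sum of a
convergent series near `0` determines the series, `f` is unique. -/
def IsFirstReturnMap (a : CoeffSeq) (f : Gc) : Prop :=
  ∀ᶠ r in 𝓝 (0 : ℂ), (∃ v, IsLipschitzSolution a v ∧ v 0 = r) ∧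
    ∀ v, IsLipschitzSolution a v → v 0 = r →
      HasSum (fun n => PowerSeries.coeff n f.series * r ^ n) (v circ)

/-- The function
`c_n(a) = ∑_{i₁ + ⋯ + i_k = n} (n - i₁ + 1)(n - i₁ - i₂ + 1) ⋯ 1 · I_{i₁, …, i_k}(a)`; here
`c.sizeUpTo j` is `i₁ + ⋯ + i_j`. -/
def returnCoeff (n : ℕ+) (a : CoeffSeq) : ℂ :=
  ∑ c : Composition (n : ℕ),
    ((∏ j ∈ Finset.range c.length, ((n : ℕ) - c.sizeUpTo (j + 1) + 1) : ℕ) : ℂ) *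
      basicInt a (c.blocks.pmap (fun i hi => ⟨i, hi⟩) fun _ hi => c.blocks_pos hi)

end CenterProblem

end

open CenterProblem

noncomputable section

namespace CenterProblem

/-! The core is an explicit Taylor expansion of the flow. Let V_n(x) be the combination of iterated
integrals over [x, 2π] with the weights of `returnCoeff` (`flowCoeff`). Peeling off the first
integration gives V_n' = -∑_{j<n} (j+1) a_{n-j} V_j almost everywhere, with V_0 = 1 and V_n(2π) = 0
for n ≥ 1. This says that U(x, v) = ∑ V_n(x) v^{n+1} formally satisfies ∂_x U + (∂_v U) ∑ a_i
v^{i+1} = 0, so U is constant along solutions. Hence v(2π) = U(2π, v(2π)) = U(0, v(0)), and U(0, r)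
is the first return map with coefficients c_n.

To make this rigorous for small Lipschitz solutions, the sum is truncated at N: the derivative along
a solution is then a geometrically small tail (`truncated_derivative`, `norm_flowCoeff_le`,
`IsLipschitzSolution.hasSum_flowCoeff`). The same identity shows that v(2π) is determined by v(0).
Existence for small r is a Banach fixed point argument.

The return map therefore depends only on the iterated integrals and descends to G(X). It is
multiplicative because a solution for a * b runs at double speed through one for a and then one for
b (`returnMap_mul`).

For surjectivity, interpolate between r and f(r) by v = f(tr)/t with t = x/2π. Differentiating,
dv/dx = (2π)⁻¹ t⁻² E(tr), where E(z) = z f'(z) - f(z). Since tr = f⁻¹(tv), the right-hand side is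
(2π)⁻¹ t⁻² Q(tv) with Q = E ∘ f⁻¹ of order at least 2. Expanding Q gives bounded coefficients a_i =
(2π)⁻¹ q_{i+1} t^{i-1} (`coeffSeqOf`).

Finally, coefficients of composites and inverses in G_c[[r]] are polynomial in finitely many
coefficients of the factors, so the group is topological. The weak topology on Q(X) is the pullback
of the one on G_c[[r]] along the algebraic isomorphism, which transports everything. -/

/-- A mean value inequality for Lipschitz functions whose derivative is bounded almost
everywhere. -/
lemma norm_sub_le_of_lipschitz {F : ℝ → ℂ} {x y : ℝ} (hxy : x ≤ y) {K : NNReal}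
    (hF : LipschitzOnWith K F (Set.Icc x y)) {ε : ℝ}
    (h : ∀ᵐ t, t ∈ Set.Icc x y → ∃ s, HasDerivAt F s t ∧ ‖s‖ ≤ ε) :
    ‖F y - F x‖ ≤ ε * (y - x) := by
  -- Pairing with the conjugate of the increment reduces to a real function: the increment of A ∘ F
  -- is ‖F y - F x‖², and the fundamental theorem for absolutely continuous functions bounds it by
  -- ‖F y - F x‖ ε (y - x).
  set u : ℂ := (starRingEnd ℂ) (F y - F x) with hu
  set A : ℂ →L[ℝ] ℝ := Complex.reCLM.comp ((ContinuousLinearMap.mul ℝ ℂ) u) with hA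
  have hAz : ∀ z, A z = (u * z).re := fun z => rfl
  have hAn : ∀ z, ‖A z‖ ≤ ‖F y - F x‖ * ‖z‖ := fun z => by
    rw [hAz, Real.norm_eq_abs]
    refine (Complex.abs_re_le_norm _).trans ?_
    rw [norm_mul, hu, RCLike.norm_conj]
  have hac : AbsolutelyContinuousOnInterval (fun t => A (F t)) x y := by
    have := (A.lipschitz.comp_lipschitzOnWith hF)
    rw [← Set.uIcc_of_le hxy] at this
    exact this.absolutelyContinuousOnInterval
  have e := hac.integral_deriv_eq_sub
  have hb : ‖∫ t in x..y, deriv (fun t => A (F t)) t‖ ≤ ‖F y - F x‖ * ε * |y - x| := by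
    refine intervalIntegral.norm_integral_le_of_norm_le_const_ae ?_
    filter_upwards [h] with t ht hmem
    rw [Set.uIoc_of_le hxy] at hmem
    obtain ⟨s, hs, hs'⟩ := ht (Set.Ioc_subset_Icc_self hmem)
    have hd : HasDerivAt (fun t => A (F t)) (A s) t := A.hasFDerivAt.comp_hasDerivAt t hs
    rw [hd.deriv]
    exact (hAn s).trans (by gcongr)
  rw [e, ← map_sub, hAz, hu, mul_comm, Complex.mul_conj, Complex.ofReal_re, Complex.normSq_eq_norm_sq,
    abs_of_nonneg (sub_nonneg.mpr hxy), Real.norm_of_nonneg (by positivity)] at hb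
  -- One factor ‖F y - F x‖ must be cancelled. If it vanishes, the claim reduces to ε ≥ 0, which
  -- follows from the bound at any single good point when x < y.
  rcases (norm_nonneg (F y - F x)).eq_or_lt with h0 | h0
  · rcases hxy.eq_or_lt with rfl | hlt
    · simp
    · have : ∃ t, t ∈ Set.Ioo x y ∧ ∃ s, HasDerivAt F s t ∧ ‖s‖ ≤ ε := by
        by_contra hcon
        push Not at hcon
        have hz : volume (Set.Ioo x y) = 0 := by
          refine measure_mono_null (fun t ht => ?_) (ae_iff.mp h)
          simp only [Set.mem_ofPred_eq, not_forall, not_exists, not_and, not_le]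
          exact ⟨Set.Ioo_subset_Icc_self ht, hcon t ht⟩
        rw [Real.volume_Ioo, ENNReal.ofReal_eq_zero] at hz
        linarith
      obtain ⟨t, -, s, -, hs⟩ := this
      rw [← h0]
      exact mul_nonneg ((norm_nonneg s).trans hs) (by linarith)
  · rw [pow_two, mul_assoc] at hb
    exact le_of_mul_le_mul_left hb h0

/-! ### Estimates for the right-hand side at small v -/

lemma hasSum_geometric_pnat {q : ℝ} (h0 : 0 ≤ q) (h1 : q < 1) :
    HasSum (fun i : ℕ+ => q ^ (i : ℕ)) (q / (1 - q)) := by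
  have := (hasSum_geometric_of_lt_one h0 h1).mul_left q
  rw [← Equiv.pnatEquivNat.hasSum_iff] at this
  convert! this using 1
  funext i
  simp only [Function.comp, Equiv.pnatEquivNat_apply]
  rw [← pow_succ', PNat.natPred_add_one]

/-- The right-hand side `∑ aᵢ(x) vⁱ⁺¹` of the equation. -/
def field (a : CoeffSeq) (x : ℝ) (v : ℂ) : ℂ := ∑' i : ℕ+, a i x * v ^ ((i : ℕ) + 1)

section Estimates

variable {a : CoeffSeq} {l ρ : ℝ}

lemma norm_term_le (ha : ∀ i x, ‖a i x‖ ≤ l ^ (i : ℕ)) {v : ℂ}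
    (hv : ‖v‖ ≤ ρ) (x : ℝ) (i : ℕ+) : ‖a i x * v ^ ((i : ℕ) + 1)‖ ≤ ρ * (l * ρ) ^ (i : ℕ) := by
  rw [norm_mul, norm_pow]
  calc ‖a i x‖ * ‖v‖ ^ ((i : ℕ) + 1) ≤ l ^ (i : ℕ) * ρ ^ ((i : ℕ) + 1) := by
        gcongr
        · exact (norm_nonneg _).trans (ha i x)
        · exact ha i x
    _ = ρ * (l * ρ) ^ (i : ℕ) := by rw [mul_pow]; ring

lemma hasSum_field (hl : 0 < l) (hlρ : l * ρ ≤ 1 / 100) (ha : ∀ i x, ‖a i x‖ ≤ l ^ (i : ℕ))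
    {v : ℂ} (hv : ‖v‖ ≤ ρ) (x : ℝ) :
    HasSum (fun i : ℕ+ => a i x * v ^ ((i : ℕ) + 1)) (field a x v) := by
  have hρ : 0 ≤ ρ := (norm_nonneg v).trans hv
  exact (Summable.of_norm_bounded ((hasSum_geometric_pnat (by positivity)
    (by linarith)).summable.mul_left ρ) fun i => norm_term_le ha hv x i).hasSum

lemma norm_field_le (hl : 0 < l) (hlρ : l * ρ ≤ 1 / 100) (ha : ∀ i x, ‖a i x‖ ≤ l ^ (i : ℕ))
    {v : ℂ} (hv : ‖v‖ ≤ ρ) (x : ℝ) : ‖field a x v‖ ≤ ρ / 49 := by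
  have hρ : 0 ≤ ρ := (norm_nonneg v).trans hv
  have h1 := (hasSum_geometric_pnat (q := l * ρ) (by positivity) (by linarith)).mul_left ρ
  refine (tsum_of_norm_bounded h1 fun i => norm_term_le ha hv x i).trans ?_
  rw [div_eq_mul_one_div ρ 49]
  refine mul_le_mul_of_nonneg_left ?_ hρ
  rw [div_le_div_iff₀ (by linarith) (by norm_num)]
  linarith

lemma norm_pow_sub_pow_le_mul {u v : ℂ} {M : ℝ} (hu : ‖u‖ ≤ M) (hv : ‖v‖ ≤ M) (n : ℕ) :
    ‖u ^ (n + 1) - v ^ (n + 1)‖ ≤ (n + 1) * M ^ n * ‖u - v‖ := by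
  have hM : 0 ≤ M := (norm_nonneg u).trans hu
  induction n with
  | zero => simp
  | succ n ih =>
    have e : u ^ (n + 1 + 1) - v ^ (n + 1 + 1) =
        u * (u ^ (n + 1) - v ^ (n + 1)) + (u - v) * v ^ (n + 1) := by ring
    rw [e]
    refine (norm_add_le _ _).trans ?_
    rw [norm_mul, norm_mul, norm_pow]
    calc ‖u‖ * ‖u ^ (n + 1) - v ^ (n + 1)‖ + ‖u - v‖ * ‖v‖ ^ (n + 1)
        ≤ M * ((n + 1) * M ^ n * ‖u - v‖) + ‖u - v‖ * M ^ (n + 1) := by gcongr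
      _ = _ := by push_cast; ring

/-- Termwise, i + 1 ≤ 2^i turns (i+1)(lρ)^i into at most 50^{-i}, and ∑_{i≥1} 50^{-i} = 1/49. As the
time interval is shorter than 7, this makes the integral operator a contraction with constant 1/7.
-/
lemma norm_field_sub_le (hl : 0 < l) (hlρ : l * ρ ≤ 1 / 100) (ha : ∀ i x, ‖a i x‖ ≤ l ^ (i : ℕ))
    {u v : ℂ} (hu : ‖u‖ ≤ ρ) (hv : ‖v‖ ≤ ρ) (x : ℝ) :
    ‖field a x u - field a x v‖ ≤ 1 / 49 * ‖u - v‖ := by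
  have hρ : 0 ≤ ρ := (norm_nonneg v).trans hv
  have h := (hasSum_field hl hlρ ha hu x).sub (hasSum_field hl hlρ ha hv x)
  have h1 := (hasSum_geometric_pnat (q := 1 / 50) (by norm_num) (by norm_num)).mul_right ‖u - v‖
  rw [← h.tsum_eq]
  refine (tsum_of_norm_bounded h1 fun i => ?_).trans (by norm_num)
  rw [← mul_sub, norm_mul]
  calc ‖a i x‖ * ‖u ^ ((i : ℕ) + 1) - v ^ ((i : ℕ) + 1)‖
      ≤ l ^ (i : ℕ) * (((i : ℕ) + 1) * ρ ^ (i : ℕ) * ‖u - v‖) := by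
        gcongr
        · exact ha i x
        · exact norm_pow_sub_pow_le_mul hu hv i
    _ = ((i : ℕ) + 1) * (l * ρ) ^ (i : ℕ) * ‖u - v‖ := by rw [mul_pow]; ring
    _ ≤ 2 ^ (i : ℕ) * (1 / 100) ^ (i : ℕ) * ‖u - v‖ := by
        gcongr
        exact_mod_cast Nat.lt_two_pow_self
    _ = (1 / 50) ^ (i : ℕ) * ‖u - v‖ := by rw [← mul_pow]; norm_num

lemma measurable_field (hl : 0 < l) (hlρ : l * ρ ≤ 1 / 100) (ha : ∀ i x, ‖a i x‖ ≤ l ^ (i : ℕ))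
    {v : ℝ → ℂ} (hvm : Measurable v) (hv : ∀ x, ‖v x‖ ≤ ρ) :
    Measurable fun x => field a x (v x) := by
  refine measurable_of_tendsto_metrizable
    (f := fun n x => ∑ i ∈ Finset.range n, a i.succPNat x * v x ^ ((i.succPNat : ℕ) + 1))
    (fun n => Finset.measurable_fun_sum _ fun i _ => ?_) ?_
  · exact (a.measurable' _).mul (hvm.pow_const _)
  · rw [tendsto_pi_nhds]
    intro x
    have := hasSum_field hl hlρ ha (hv x) x
    rw [← Equiv.pnatEquivNat.symm.hasSum_iff] at this
    exact this.tendsto_sum_nat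

end Estimates

/-! ### Existence and a priori bounds for small solutions -/

lemma circ_lt : circ < 7 := by have := Real.pi_lt_d2; unfold circ; linarith

/-- The continuous function on `ℝ` extending a function on `[0, 2π]` by constants. -/
def extendCirc (v : C(Set.Icc 0 circ, ℂ)) : ℝ → ℂ := Set.IccExtend circ_pos.le v

lemma continuous_extendCirc (v : C(Set.Icc 0 circ, ℂ)) : Continuous (extendCirc v) :=
  v.continuous.Icc_extend'

lemma norm_extendCirc_le {v : C(Set.Icc 0 circ, ℂ)} {ρ : ℝ} (hv : ∀ x, ‖v x‖ ≤ ρ) (x : ℝ) :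
    ‖extendCirc v x‖ ≤ ρ := hv _

lemma intervalIntegrable_of_bounded {f : ℝ → ℂ} (hf : Measurable f) {C : ℝ} (h : ∀ x, ‖f x‖ ≤ C)
    (x y : ℝ) : IntervalIntegrable f volume x y := by
  rw [intervalIntegrable_iff]
  exact Measure.integrableOn_of_bounded (M := C) (by simp)
      hf.aestronglyMeasurable (Eventually.of_forall h)

/-- For small initial values the equation has a Lipschitz solution. -/
lemma exists_isLipschitzSolution {a : CoeffSeq} {l ρ : ℝ} (hl : 0 < l) (hρ : 0 < ρ)
    (hlρ : l * ρ ≤ 1 / 100) (ha : ∀ i x, ‖a i x‖ ≤ l ^ (i : ℕ)) {r : ℂ} (hr : ‖r‖ ≤ ρ / 2) :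
    ∃ v, IsLipschitzSolution a v ∧ v 0 = r := by
  -- the fields along continuous functions bounded by `ρ`
  set B : Set C(Set.Icc 0 circ, ℂ) := Metric.closedBall 0 ρ with hB
  have hBn : ∀ v ∈ B, ∀ x, ‖v x‖ ≤ ρ := fun v hv x => by
    rw [hB, mem_closedBall_zero_iff] at hv
    exact (v.norm_coe_le_norm x).trans hv
  have hm : ∀ v ∈ B, Measurable fun x => field a x (extendCirc v x) := fun v hv =>
    measurable_field hl hlρ ha (continuous_extendCirc v).measurable
      (norm_extendCirc_le (hBn v hv))
  have hbd : ∀ v ∈ B, ∀ x, ‖field a x (extendCirc v x)‖ ≤ ρ / 49 := fun v hv x =>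
    norm_field_le hl hlρ ha (norm_extendCirc_le (hBn v hv) x) x
  have hii : ∀ v ∈ B, ∀ x y, IntervalIntegrable (fun x => field a x (extendCirc v x)) volume x y :=
    fun v hv => intervalIntegrable_of_bounded (hm v hv) (hbd v hv)
  have hcont : ∀ v ∈ B, Continuous fun x => r + ∫ s in (0 : ℝ)..x, field a s (extendCirc v s) :=
    fun v hv => continuous_const.add (intervalIntegral.continuous_primitive (hii v hv) 0)
  classical
  -- Picard's operator. Outside the ball B the series need not converge, so T is the identity there;
  -- only its restriction to B is used.
  set T : C(Set.Icc 0 circ, ℂ) → C(Set.Icc 0 circ, ℂ) := fun v =>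
    if hv : v ∈ B then ⟨_, (hcont v hv).comp continuous_subtype_val⟩ else v with hT
  have hTv : ∀ v ∈ B, ∀ x : Set.Icc 0 circ,
      T v x = r + ∫ s in (0 : ℝ)..x, field a s (extendCirc v s) := fun v hv x => by
    simp only [hT, dif_pos hv]; rfl
  have hmaps : Set.MapsTo T B B := by
    intro v hv
    rw [hB, mem_closedBall_zero_iff, ContinuousMap.norm_le _ hρ.le]
    intro x
    rw [hTv v hv]
    refine (norm_add_le _ _).trans ?_
    have h1 : ‖∫ s in (0 : ℝ)..x, field a s (extendCirc v s)‖ ≤ ρ / 49 * |(x : ℝ) - 0| :=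
      intervalIntegral.norm_integral_le_of_norm_le_const fun s _ => hbd v hv s
    have h2 : |(x : ℝ) - 0| ≤ 7 := by
      rw [sub_zero, abs_of_nonneg x.2.1]; exact x.2.2.trans circ_lt.le
    nlinarith
  have hcontr : ContractingWith (1 / 7) (hmaps.restrict T B B) := by
    refine ⟨by rw [← NNReal.coe_lt_coe]; norm_num, LipschitzWith.of_dist_le_mul fun u v => ?_⟩
    rw [Subtype.dist_eq, ContinuousMap.dist_le (by positivity)]
    intro x
    simp only [Set.MapsTo.val_restrict_apply]
    rw [hTv _ u.2, hTv _ v.2, dist_add_left, dist_eq_norm,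
      ← intervalIntegral.integral_sub (hii _ u.2 _ _) (hii _ v.2 _ _)]
    refine (intervalIntegral.norm_integral_le_of_norm_le_const
      (C := 1 / 49 * dist u.1 v.1) fun s _ => ?_).trans ?_
    · refine (norm_field_sub_le hl hlρ ha (norm_extendCirc_le (hBn _ u.2) s)
        (norm_extendCirc_le (hBn _ v.2) s) s).trans ?_
      gcongr
      rw [← dist_eq_norm]
      exact ContinuousMap.dist_apply_le_dist _
    · have h2 : |(x : ℝ) - 0| ≤ 7 := by
        rw [sub_zero, abs_of_nonneg x.2.1]; exact x.2.2.trans circ_lt.le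
      have h3 : 0 ≤ dist u.1 v.1 := dist_nonneg
      rw [Subtype.dist_eq]
      push_cast
      nlinarith
  obtain ⟨w, hwB, hw, -⟩ := ContractingWith.exists_fixedPoint' (Metric.isClosed_closedBall.isComplete)
    hmaps hcontr (x := 0) (by simp [hB, hρ.le]) (edist_ne_top _ _)
  -- The fixed point lives on [0, 2π] only. The integral formula defines v on all of ℝ, so that
  -- two-sided derivatives come from Lebesgue differentiation.
  set v : ℝ → ℂ := fun x => r + ∫ s in (0 : ℝ)..x, field a s (extendCirc w s) with hvdef
  have hvw : ∀ x ∈ Set.Icc 0 circ, v x = extendCirc w x := by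
    intro x hx
    have h1 : T w ⟨x, hx⟩ = w ⟨x, hx⟩ := by rw [hw]
    rw [hTv w hwB] at h1
    rw [extendCirc, Set.IccExtend_of_mem _ _ hx]
    exact h1
  refine ⟨v, ⟨⟨⟨ρ / 49, by positivity⟩, ?_⟩, ?_⟩, by simp [hvdef]⟩
  · refine LipschitzOnWith.of_dist_le_mul fun x _ y _ => ?_
    rw [hvdef, dist_add_left, dist_eq_norm, intervalIntegral.integral_interval_sub_left
      (hii w hwB _ _) (hii w hwB _ _)]
    refine (intervalIntegral.norm_integral_le_of_norm_le_const fun s _ => hbd w hwB s).trans ?_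
    rw [Real.dist_eq]; rfl
  · rw [ae_restrict_iff' measurableSet_Icc]
    have hli : LocallyIntegrable (fun x => field a x (extendCirc w x)) volume := fun x =>
      ⟨Set.Icc (x - 1) (x + 1), Icc_mem_nhds (by linarith) (by linarith), by
        have := hii w hwB (x - 1) (x + 1)
        rwa [intervalIntegrable_iff_integrableOn_Icc_of_le (by linarith)] at this⟩
    filter_upwards [LocallyIntegrable.ae_hasDerivAt_integral hli] with x hx hxm
    refine ⟨field a x (v x), ?_, ?_⟩
    · refine hasSum_field hl hlρ ha ?_ x
      rw [hvw x hxm]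
      exact norm_extendCirc_le (hBn w hwB) x
    · rw [hvw x hxm]
      exact (hx 0).const_add r

/-- A first exit argument: up to the first time with ‖v‖ ≥ ρ the speed is at most ρ/49, so in time
less than 7 the solution moves by less than ρ/7, and starting within ρ/2 it cannot reach norm ρ. -/
lemma IsLipschitzSolution.norm_lt {a : CoeffSeq} {l ρ : ℝ} (hl : 0 < l) (hρ : 0 < ρ)
    (hlρ : l * ρ ≤ 1 / 100) (ha : ∀ i x, ‖a i x‖ ≤ l ^ (i : ℕ)) {v : ℝ → ℂ}
    (hv : IsLipschitzSolution a v) (h0 : ‖v 0‖ ≤ ρ / 2) : ∀ x ∈ Set.Icc 0 circ, ‖v x‖ < ρ := by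
  by_contra hcon
  push Not at hcon
  obtain ⟨K, hK⟩ := hv.lipschitz
  set S : Set ℝ := Set.Icc 0 circ ∩ (fun x => ‖v x‖) ⁻¹' Set.Ici ρ with hS
  have hcl : IsClosed S := hK.continuousOn.norm.preimage_isClosed_of_isClosed isClosed_Icc isClosed_Ici
  have hcp : IsCompact S := isCompact_Icc.of_isClosed_subset hcl Set.inter_subset_left
  obtain ⟨x, ⟨hx, hx'⟩, hmin⟩ := hcp.exists_isLeast (by
    obtain ⟨x, hx, hx'⟩ := hcon
    exact ⟨x, hx, hx'⟩)
  have hsub : Set.Icc 0 x ⊆ Set.Icc 0 circ := Set.Icc_subset_Icc_right hx.2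
  have h1 : ‖v x - v 0‖ ≤ ρ / 49 * (x - 0) := by
    refine norm_sub_le_of_lipschitz hx.1 (hK.mono hsub) ?_
    -- Minimality of x gives ‖v t‖ < ρ only for t < x; the single point x is discarded as a null
    -- set.
    have hne : ∀ᵐ t : ℝ, t ≠ x := by simp [ae_iff, measure_singleton]
    filter_upwards [(ae_restrict_iff' measurableSet_Icc).mp hv.ode, hne] with t ht htx htm
    obtain ⟨s, hs, hs'⟩ := ht (hsub htm)
    have hvt : ‖v t‖ ≤ ρ := by
      by_contra hgt
      have := hmin ⟨hsub htm, (not_le.mp hgt).le⟩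
      exact htx (le_antisymm htm.2 this)
    refine ⟨s, hs', ?_⟩
    rw [hs.unique (hasSum_field hl hlρ ha hvt t)]
    exact norm_field_le hl hlρ ha hvt t
  have h2 : ‖v x‖ ≤ ‖v x - v 0‖ + ‖v 0‖ := by
    simpa using norm_add_le (v x - v 0) (v 0)
  have h3 : x < 7 := hx.2.trans_lt circ_lt
  have h4 : ρ ≤ ‖v x‖ := hx'
  nlinarith

/-! ### The Taylor coefficients of the flow -/

/-- The blocks of a composition, as a list of positive integers. -/
def pnatBlocks {n : ℕ} (c : Composition n) : List ℕ+ :=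
  c.blocks.pmap (fun i hi => ⟨i, hi⟩) fun _ hi => c.blocks_pos hi

/-- The composition obtained by adding a first block. -/
def consBlock (n : ℕ) (x : Σ j : Fin (n + 1), Composition j) : Composition (n + 1) where
  blocks := (n - x.1 + 1) :: x.2.blocks
  blocks_pos := by
    intro i hi
    rcases List.mem_cons.mp hi with rfl | h
    · omega
    · exact x.2.blocks_pos h
  blocks_sum := by
    rw [List.sum_cons, x.2.blocks_sum]
    have := x.1.2
    omega

lemma consBlock_bijective (n : ℕ) : Function.Bijective (consBlock n) := by
  constructor
  · rintro ⟨i, c⟩ ⟨j, c'⟩ h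
    have hb : (n - i + 1) :: c.blocks = (n - j + 1) :: c'.blocks := congrArg Composition.blocks h
    rw [List.cons.injEq] at hb
    have hij : i = j := by
      ext
      have := i.2
      have := j.2
      omega
    subst hij
    rw [Composition.ext hb.2]
  · intro c
    obtain ⟨bl, hpos, hsum⟩ := c
    cases bl with
    | nil => simp at hsum
    | cons i L =>
      have hi : 0 < i := hpos (List.mem_cons_self ..)
      rw [List.sum_cons] at hsum
      refine ⟨⟨⟨L.sum, by omega⟩, ⟨L, fun h => hpos (List.mem_cons_of_mem _ h), rfl⟩⟩, ?_⟩
      ext1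
      simp only [consBlock, List.cons.injEq, and_true]
      omega

/-- Compositions of n + 1 are grouped by the total j left after the first block, which is then n + 1
- j, that is `(n - j).succPNat`. -/
lemma sum_composition_succ {M : Type*} [AddCommMonoid M] (φ : List ℕ+ → M) (n : ℕ) :
    ∑ c : Composition (n + 1), φ (pnatBlocks c) =
      ∑ j ∈ Finset.range (n + 1), ∑ c : Composition j, φ ((n - j).succPNat :: pnatBlocks c) := by
  rw [Finset.sum_range (fun j => ∑ c : Composition j, φ ((n - j).succPNat :: pnatBlocks c)),
    ← Fintype.sum_sigma' (fun (j : Fin (n + 1)) (c : Composition j) =>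
      φ ((n - j).succPNat :: pnatBlocks c))]
  exact (Fintype.sum_bijective (consBlock n) (consBlock_bijective n) _ _ fun x => rfl).symm

/-- The integer weight of an iterated integral in the expansion of the flow. -/
def weight : List ℕ+ → ℕ
  | [] => 1
  | _ :: L => ((L.map (fun i : ℕ+ => (i : ℕ))).sum + 1) * weight L

lemma map_val_pnatBlocks {n : ℕ} (c : Composition n) :
    (pnatBlocks c).map (fun i : ℕ+ => (i : ℕ)) = c.blocks := by
  rw [pnatBlocks]
  generalize_proofs h
  generalize c.blocks = L at h
  induction L with
  | nil => rfl
  | cons i L ih => exact congrArg (i :: ·) (ih _)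

/-- A tail sum is the total minus a partial sum. This links the recursive weight, suited to peeling
off one integration, to the product in `returnCoeff`. -/
lemma weight_eq_prod (L : List ℕ+) :
    weight L = ∏ j ∈ Finset.range L.length, ((L.map (fun i : ℕ+ => (i : ℕ))).sum -
      ((L.map (fun i : ℕ+ => (i : ℕ))).take (j + 1)).sum + 1) := by
  induction L with
  | nil => rfl
  | cons i L ih =>
    rw [weight, List.length_cons, Finset.prod_range_succ', ih, mul_comm]
    congr 1
    · refine Finset.prod_congr rfl fun j _ => ?_
      simp [List.map_cons, List.take_succ_cons, List.sum_cons, Nat.add_sub_add_left]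
    · simp

/-- The coefficients of the flow from time `x` to time `2π`. -/
def flowCoeff (a : CoeffSeq) (n : ℕ) (x : ℝ) : ℂ :=
  ∑ c : Composition n, (weight (pnatBlocks c) : ℂ) * iterInt a (pnatBlocks c) x circ

lemma flowCoeff_eq_returnCoeff (a : CoeffSeq) (n : ℕ+) : flowCoeff a n 0 = returnCoeff n a := by
  refine Finset.sum_congr rfl fun c _ => ?_
  have hlen : (pnatBlocks c).length = c.length := by
    rw [← Composition.blocks_length, ← map_val_pnatBlocks c, List.length_map]
  have hw : weight (pnatBlocks c) =
      ∏ j ∈ Finset.range c.length, ((n : ℕ) - c.sizeUpTo (j + 1) + 1) := by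
    rw [weight_eq_prod, map_val_pnatBlocks, c.blocks_sum, hlen]
    rfl
  rw [hw]
  rfl

lemma flowCoeff_zero (a : CoeffSeq) (x : ℝ) : flowCoeff a 0 x = 1 := by
  have : ∀ c : Composition 0, pnatBlocks c = [] := fun c => by
    have h : c.blocks = [] := c.blocks_eq_nil.mpr rfl
    rw [← map_val_pnatBlocks, List.map_eq_nil_iff] at h
    exact h
  have hcard : Fintype.card (Composition 0) = 1 := by rw [composition_card]; rfl
  simp [flowCoeff, this, weight, iterInt, hcard]

lemma flowCoeff_succ_circ (a : CoeffSeq) (n : ℕ) : flowCoeff a (n + 1) circ = 0 := by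
  rw [flowCoeff, sum_composition_succ (fun L => (weight L : ℂ) * iterInt a L circ circ)]
  simp [iterInt]

lemma continuous_flowCoeff (a : CoeffSeq) (n : ℕ) : Continuous (flowCoeff a n) :=
  continuous_finsetSum _ fun _ _ => continuous_const.mul (continuous_iterInt a _ circ)

/-- Minus the derivative of the flow coefficients. -/
def flowRate (a : CoeffSeq) (n : ℕ) (x : ℝ) : ℂ :=
  ∑ j ∈ Finset.range n, (j + 1) * a (n - 1 - j).succPNat x * flowCoeff a j x

lemma intervalIntegrable_flowRate (a : CoeffSeq) (n : ℕ) (x y : ℝ) :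
    IntervalIntegrable (flowRate a n) volume x y := by
  have : flowRate a n = fun x => ∑ j ∈ Finset.range n,
      a (n - 1 - j).succPNat x * ((j + 1) * flowCoeff a j x) := by
    funext x
    exact Finset.sum_congr rfl fun j _ => by ring
  rw [this]
  have h : ∀ j : ℕ, IntervalIntegrable
      (fun s => a (n - 1 - j).succPNat s * (((j : ℂ) + 1) * flowCoeff a j s)) volume x y := fun j =>
    intervalIntegrable_mul a _ (continuous_const.mul (continuous_flowCoeff a j)) x y
  convert! IntervalIntegrable.sum (Finset.range n) fun j _ => h j using 1
  funext s
  simp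

/-- The outer integration variable belongs to the first block; if j remains after that block, the
weight acquires exactly the factor j + 1 occurring in `flowRate`. -/
lemma flowCoeff_succ (a : CoeffSeq) (n : ℕ) (x : ℝ) :
    flowCoeff a (n + 1) x = ∫ s in x..circ, flowRate a (n + 1) s := by
  have h1 : ∀ j, IntervalIntegrable
      (fun s => (j + 1) * a (n + 1 - 1 - j).succPNat s * flowCoeff a j s) volume x circ := by
    intro j
    have hc : Continuous fun s => ((j : ℂ) + 1) * flowCoeff a j s :=
      continuous_const.mul (continuous_flowCoeff a j)
    refine (intervalIntegrable_mul a (n + 1 - 1 - j).succPNat hc x circ).congr fun s _ => ?_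
    ring
  rw [flowCoeff, sum_composition_succ (fun L => (weight L : ℂ) * iterInt a L x circ)]
  simp only [flowRate]
  rw [intervalIntegral.integral_finsetSum fun j _ => h1 j]
  refine Finset.sum_congr rfl fun j _ => ?_
  have h2 : ∀ s, (j + 1) * a (n + 1 - 1 - j).succPNat s * flowCoeff a j s =
      ∑ c : Composition j, (weight ((n - j).succPNat :: pnatBlocks c) : ℂ) *
        (a (n - j).succPNat s * iterInt a (pnatBlocks c) s circ) := by
    intro s
    rw [flowCoeff, Finset.mul_sum]
    refine Finset.sum_congr rfl fun c _ => ?_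
    rw [weight, map_val_pnatBlocks, c.blocks_sum]
    push_cast
    ring
  simp only [h2]
  rw [intervalIntegral.integral_finsetSum]
  · refine Finset.sum_congr rfl fun c _ => ?_
    rw [intervalIntegral.integral_const_mul, iterInt]
  · exact fun c _ => (intervalIntegrable_mul a _ (continuous_iterInt a _ circ) x circ).const_mul _

lemma flowCoeff_eq_integral (a : CoeffSeq) (n : ℕ) (x : ℝ) :
    flowCoeff a n x = flowCoeff a n circ + ∫ s in x..circ, flowRate a n s := by
  cases n with
  | zero => simp [flowCoeff_zero, flowRate]
  | succ n => rw [flowCoeff_succ_circ, zero_add, flowCoeff_succ]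

lemma ae_hasDerivAt_flowCoeff (a : CoeffSeq) (n : ℕ) :
    ∀ᵐ x, HasDerivAt (flowCoeff a n) (-flowRate a n x) x := by
  have hli : LocallyIntegrable (flowRate a n) volume := fun x =>
      ⟨Set.Icc (x - 1) (x + 1), Icc_mem_nhds (by linarith) (by linarith), by
        have := intervalIntegrable_flowRate a n (x - 1) (x + 1)
        rwa [intervalIntegrable_iff_integrableOn_Icc_of_le (by linarith)] at this⟩
  filter_upwards [LocallyIntegrable.ae_hasDerivAt_integral hli] with x hx
  have := ((hx circ).neg).const_add (flowCoeff a n circ)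
  refine this.congr_of_eventuallyEq (Eventually.of_forall fun y => ?_)
  rw [flowCoeff_eq_integral]
  rw [intervalIntegral.integral_symm]
  rfl

/-- The bound is the t-derivative of (2l e^t)^{n+1}. The exponential is there to absorb the factor n
+ 1, which integration removes again; the 2 absorbs the sum over j through ∑_{j≤n} 2^j ≤ 2^{n+1}. -/
lemma norm_flowRate_le {a : CoeffSeq} {l : ℝ} (hl : 0 < l)
    (ha : ∀ i x, ‖a i x‖ ≤ l ^ (i : ℕ)) (n : ℕ) {t x : ℝ} (ht : 0 ≤ t)
    (h : ∀ j ≤ n, ‖flowCoeff a j x‖ ≤ (2 * l * Real.exp t) ^ j) :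
    ‖flowRate a (n + 1) x‖ ≤ (2 * l) ^ (n + 1) * ((n + 1) * Real.exp ((n + 1) * t)) := by
  have hexp : Real.exp ((n + 1) * t) = Real.exp t ^ (n + 1) := by
    rw [← Real.exp_nat_mul]; push_cast; rfl
  have h1 : ∀ j ∈ Finset.range (n + 1),
      ‖(j + 1) * a (n + 1 - 1 - j).succPNat x * flowCoeff a j x‖ ≤
        l ^ (n + 1) * ((n + 1) * Real.exp ((n + 1) * t)) * 2 ^ j := by
    intro j hj
    have hj : j ≤ n := Nat.lt_succ_iff.mp (Finset.mem_range.mp hj)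
    rw [norm_mul, norm_mul]
    have e1 : ‖(j : ℂ) + 1‖ = j + 1 := by exact_mod_cast Complex.norm_natCast (j + 1)
    rw [e1]
    have e2 : Real.exp t ^ j ≤ Real.exp ((n + 1) * t) := by
      rw [hexp]
      exact pow_le_pow_right₀ (Real.one_le_exp ht) (by omega)
    have e3 : l ^ ((n + 1 - 1 - j).succPNat : ℕ) * l ^ j = l ^ (n + 1) := by
      rw [← pow_add]; congr 1; simp; omega
    calc (j + 1) * ‖a (n + 1 - 1 - j).succPNat x‖ * ‖flowCoeff a j x‖
        ≤ (n + 1) * l ^ ((n + 1 - 1 - j).succPNat : ℕ) * (2 * l * Real.exp t) ^ j := by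
          gcongr
          · exact ha _ x
          · exact h j hj
      _ = (l ^ ((n + 1 - 1 - j).succPNat : ℕ) * l ^ j) * ((n + 1) * Real.exp t ^ j) * 2 ^ j := by
          rw [mul_pow, mul_pow]; ring
      _ ≤ _ := by rw [e3]; gcongr
  refine (norm_sum_le_of_le _ h1).trans ?_
  rw [← Finset.mul_sum, mul_pow]
  have e : ∑ j ∈ Finset.range (n + 1), (2 : ℝ) ^ j ≤ 2 ^ (n + 1) := by
    rw [geom_sum_eq (by norm_num)]; norm_num
  have e2 : 0 ≤ l ^ (n + 1) * ((n + 1) * Real.exp ((n + 1) * t)) := by positivity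
  nlinarith [mul_le_mul_of_nonneg_left e e2]

lemma norm_flowCoeff_le {a : CoeffSeq} {l : ℝ} (hl : 0 < l)
    (ha : ∀ i x, ‖a i x‖ ≤ l ^ (i : ℕ)) (n : ℕ) :
    ∀ x ≤ circ, ‖flowCoeff a n x‖ ≤ (2 * l * Real.exp (circ - x)) ^ n := by
  induction n using Nat.strong_induction_on with
  | _ n ih =>
  cases n with
  | zero => intro x _; simp [flowCoeff_zero]
  | succ n =>
    intro x hx
    have hb : ∀ s ∈ Set.Ioc x circ, ‖flowRate a (n + 1) s‖ ≤
        (2 * l) ^ (n + 1) * ((n + 1) * Real.exp ((n + 1) * (circ - s))) := fun s hs =>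
      norm_flowRate_le hl ha n (by linarith [hs.2]) fun j hj => ih j (by omega) s hs.2
    have hder : ∀ s ∈ Set.uIcc x circ,
        HasDerivAt (fun s => -((2 * l) ^ (n + 1) * Real.exp ((n + 1) * (circ - s))))
          ((2 * l) ^ (n + 1) * ((n + 1) * Real.exp ((n + 1) * (circ - s)))) s := by
      intro s _
      have h1 : HasDerivAt (fun s : ℝ => ((n : ℝ) + 1) * (circ - s)) (((n : ℝ) + 1) * (-1)) s :=
        ((hasDerivAt_id s).const_sub circ).const_mul _
      convert! (h1.exp.const_mul ((2 * l) ^ (n + 1))).neg using 1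
      ring
    have hc : Continuous fun s => (2 * l) ^ (n + 1) * ((n + 1) * Real.exp ((n + 1) * (circ - s))) := by
      fun_prop
    rw [flowCoeff_succ]
    refine (intervalIntegral.norm_integral_le_of_norm_le hx
      (Eventually.of_forall hb) (hc.intervalIntegrable _ _)).trans ?_
    rw [intervalIntegral.integral_eq_sub_of_hasDerivAt hder (hc.intervalIntegrable _ _)]
    rw [mul_pow (2 * l), ← Real.exp_nat_mul]
    push_cast
    have : 0 ≤ (2 * l) ^ (n + 1) * Real.exp ((n + 1) * (circ - circ)) := by positivity
    linarith

/-! ### The first return map as a convergent series -/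

lemma exists_lipschitzOnWith_mul {f g : ℝ → ℂ} {x y : ℝ}
    (hf : ∃ K, LipschitzOnWith K f (Set.Icc x y)) (hg : ∃ K, LipschitzOnWith K g (Set.Icc x y)) :
    ∃ K, LipschitzOnWith K (fun t => f t * g t) (Set.Icc x y) := by
  obtain ⟨K, hK⟩ := hf
  obtain ⟨L, hL⟩ := hg
  obtain ⟨A, hA⟩ := isCompact_Icc.exists_bound_of_continuousOn hK.continuousOn
  obtain ⟨B, hB⟩ := isCompact_Icc.exists_bound_of_continuousOn hL.continuousOn
  refine ⟨A.toNNReal * L + K * B.toNNReal, LipschitzOnWith.of_dist_le_mul fun s hs t ht => ?_⟩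
  have e : f s * g s - f t * g t = f s * (g s - g t) + (f s - f t) * g t := by ring
  rw [dist_eq_norm, e]
  refine (norm_add_le _ _).trans ?_
  rw [norm_mul, norm_mul, ← dist_eq_norm, ← dist_eq_norm]
  push_cast
  calc ‖f s‖ * dist (g s) (g t) + dist (f s) (f t) * ‖g t‖
      ≤ A.toNNReal * (L * dist s t) + (K * dist s t) * B.toNNReal := by
        gcongr
        · exact (hA s hs).trans (Real.le_coe_toNNReal A)
        · exact hL.dist_le_mul s hs t ht
        · exact hK.dist_le_mul s hs t ht
        · exact (hB t ht).trans (Real.le_coe_toNNReal B)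
    _ = _ := by ring

lemma exists_lipschitzOnWith_pow {f : ℝ → ℂ} {x y : ℝ}
    (hf : ∃ K, LipschitzOnWith K f (Set.Icc x y)) (n : ℕ) :
    ∃ K, LipschitzOnWith K (fun t => f t ^ n) (Set.Icc x y) := by
  induction n with
  | zero => exact ⟨0, by simp⟩
  | succ n ih => simpa only [pow_succ] using exists_lipschitzOnWith_mul ih hf

lemma exists_lipschitzOnWith_sum {ι : Type*} (S : Finset ι) {f : ι → ℝ → ℂ} {x y : ℝ}
    (hf : ∀ i, ∃ K, LipschitzOnWith K (f i) (Set.Icc x y)) :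
    ∃ K, LipschitzOnWith K (fun t => ∑ i ∈ S, f i t) (Set.Icc x y) := by
  classical
  induction S using Finset.induction_on with
  | empty => exact ⟨0, by simp⟩
  | insert i S hi ih =>
    obtain ⟨K, hK⟩ := hf i
    obtain ⟨L, hL⟩ := ih
    simp only [Finset.sum_insert hi]
    exact ⟨K + L, hK.add hL⟩

lemma exists_lipschitzOnWith_flowCoeff (a : CoeffSeq) (n : ℕ) :
    ∃ K, LipschitzOnWith K (flowCoeff a n) (Set.Icc 0 circ) := by
  obtain ⟨l, hl, ha⟩ := a.bound'
  cases n with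
  | zero =>
    have : flowCoeff a 0 = fun _ => 1 := funext (flowCoeff_zero a)
    exact ⟨0, by simp [this]⟩
  | succ n =>
    set C : ℝ := (2 * l) ^ (n + 1) * ((n + 1) * Real.exp ((n + 1) * circ)) with hC
    have hb : ∀ s ∈ Set.Icc 0 circ, ‖flowRate a (n + 1) s‖ ≤ C := by
      intro s hs
      refine norm_flowRate_le hl ha n circ_pos.le fun j _ =>
        (norm_flowCoeff_le hl ha j s hs.2).trans ?_
      gcongr
      linarith [hs.1]
    refine ⟨C.toNNReal, LipschitzOnWith.of_dist_le_mul fun x hx y hy => ?_⟩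
    rw [flowCoeff_succ, flowCoeff_succ, dist_eq_norm, intervalIntegral.integral_interval_sub_interval_comm'
      (intervalIntegrable_flowRate a _ _ _) (intervalIntegrable_flowRate a _ _ _)
      (intervalIntegrable_flowRate a _ _ _), intervalIntegral.integral_same, zero_sub, norm_neg,
      Real.coe_toNNReal _ (by positivity), Real.dist_eq]
    refine intervalIntegral.norm_integral_le_of_norm_le_const fun s hs => hb s ?_
    exact Set.uIcc_subset_Icc hy hx (Set.uIoc_subset_uIcc hs)

/-- The telescoping identity behind the invariance of the truncated flow along solutions. -/
lemma truncated_derivative (b V : ℕ → ℂ) (v s : ℂ) (N : ℕ) :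
    ∑ n ∈ Finset.range (N + 1),
      (-(∑ j ∈ Finset.range n, (j + 1) * b (n - 1 - j) * V j) * v ^ (n + 1) +
        V n * ((n + 1) * v ^ n * s)) =
      ∑ m ∈ Finset.range (N + 1), (m + 1) * V m * v ^ m *
        (s - ∑ j ∈ Finset.range (N - m), b j * v ^ (j + 2)) := by
  induction N with
  | zero => simp
  | succ N ih =>
    rw [Finset.sum_range_succ, ih, Finset.sum_range_succ _ (N + 1), Nat.sub_self,
      Finset.range_zero, Finset.sum_empty, neg_mul, Finset.sum_mul, ← add_assoc,
      ← Finset.sum_neg_distrib, ← Finset.sum_add_distrib]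
    congr 1
    -- The new summand n = N + 1 supplies, for each m ≤ N, the next term b (N - m) v^{N-m+2} of the
    -- truncated field.
    · refine Finset.sum_congr rfl fun m hm => ?_
      have hm : m ≤ N := Nat.lt_succ_iff.mp (Finset.mem_range.mp hm)
      rw [Nat.sub_add_comm hm, Finset.sum_range_succ]
      have e1 : N + 1 - 1 - m = N - m := by omega
      have e2 : v ^ (N + 1 + 1) = v ^ m * v ^ (N - m + 2) := by
        rw [← pow_add]; congr 1; omega
      rw [e1, e2]
      ring
    · push_cast
      ring

lemma norm_field_tail_le {a : CoeffSeq} {l ρ : ℝ} (hl : 0 < l)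
    (hlρ : l * ρ ≤ 1 / 100) (ha : ∀ i x, ‖a i x‖ ≤ l ^ (i : ℕ)) {v : ℂ} (hv : ‖v‖ ≤ ρ) (x : ℝ)
    (k : ℕ) : ‖field a x v - ∑ j ∈ Finset.range k, a j.succPNat x * v ^ (j + 2)‖ ≤
      ρ * (1 / 50) ^ k := by
  have hρ : 0 ≤ ρ := (norm_nonneg v).trans hv
  have h := hasSum_field hl hlρ ha hv x
  rw [← Equiv.pnatEquivNat.symm.hasSum_iff] at h
  rw [norm_sub_rev]
  refine (norm_sub_le_of_geometric_bound_of_hasSum (r := 1 / 50) (C := ρ / 50) (by norm_num)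
    (fun j => ?_) h k).trans ?_
  · refine (norm_term_le ha hv x _).trans ?_
    have : ((Equiv.pnatEquivNat.symm j : ℕ+) : ℕ) = j + 1 := rfl
    rw [this]
    have h2 : (l * ρ) ^ (j + 1) ≤ (1 / 50) ^ (j + 1) := by gcongr; linarith
    calc ρ * (l * ρ) ^ (j + 1) ≤ ρ * (1 / 50) ^ (j + 1) := by gcongr
      _ = _ := by ring
  · rw [div_le_iff₀ (by norm_num)]
    have : 0 ≤ ρ * (1 / 50) ^ k := by positivity
    linarith

/-- The factor e^{2π} in the smallness condition pays for the growth of the coefficients over the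
whole interval; what remains is (2/100)^n. -/
lemma norm_flowCoeff_mul_pow_le {a : CoeffSeq} {l ρ : ℝ} (hl : 0 < l)
    (hlρ : l * ρ * Real.exp circ ≤ 1 / 100) (ha : ∀ i x, ‖a i x‖ ≤ l ^ (i : ℕ)) {v : ℂ}
    (hv : ‖v‖ ≤ ρ) {x : ℝ} (hx : x ∈ Set.Icc 0 circ) (n : ℕ) :
    ‖flowCoeff a n x * v ^ n‖ ≤ (1 / 50) ^ n := by
  rw [norm_mul, norm_pow]
  calc ‖flowCoeff a n x‖ * ‖v‖ ^ n ≤ (2 * l * Real.exp circ) ^ n * ρ ^ n := by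
        gcongr
        refine (norm_flowCoeff_le hl ha n x hx.2).trans ?_
        gcongr
        linarith [hx.1]
    _ = (2 * (l * ρ * Real.exp circ)) ^ n := by rw [← mul_pow]; ring
    _ ≤ _ := by
        have hρ : 0 ≤ ρ := (norm_nonneg v).trans hv
        gcongr
        linarith

/-- The truncations G N of U along v equal v(2π) at 2π. Their derivatives are O(N² 50^{-N}), so G N
0, the partial sums at v(0), tend to v(2π). No separate uniqueness theorem for the equation is
needed. -/
lemma IsLipschitzSolution.hasSum_flowCoeff {a : CoeffSeq} {l ρ : ℝ} (hl : 0 < l) (hρ : 0 < ρ)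
    (hlρ : l * ρ * Real.exp circ ≤ 1 / 100) (ha : ∀ i x, ‖a i x‖ ≤ l ^ (i : ℕ)) {v : ℝ → ℂ}
    (hv : IsLipschitzSolution a v) (h0 : ‖v 0‖ ≤ ρ / 2) :
    HasSum (fun n => flowCoeff a n 0 * v 0 ^ (n + 1)) (v circ) := by
  have hlρ' : l * ρ ≤ 1 / 100 := by
    have h1 := Real.one_le_exp circ_pos.le
    have h2 : 0 < l * ρ := by positivity
    nlinarith
  have hlt := hv.norm_lt hl hρ hlρ' ha h0
  have hzero : (0 : ℝ) ∈ Set.Icc 0 circ := Set.left_mem_Icc.mpr circ_pos.le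
  have hcirc : circ ∈ Set.Icc 0 circ := Set.right_mem_Icc.mpr circ_pos.le
  set G : ℕ → ℝ → ℂ := fun N x =>
    ∑ n ∈ Finset.range (N + 1), flowCoeff a n x * v x ^ (n + 1) with hG
  have hGc : ∀ N, G N circ = v circ := by
    intro N
    simp only [hG]
    rw [Finset.sum_range_succ']
    simp [flowCoeff_succ_circ, flowCoeff_zero]
  have hbound : ∀ N, ‖G N circ - G N 0‖ ≤ ρ * (N + 1) ^ 2 * (1 / 50) ^ N * (circ - 0) := by
    intro N
    obtain ⟨K, hK⟩ := exists_lipschitzOnWith_sum (Finset.range (N + 1)) fun n =>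
      exists_lipschitzOnWith_mul (exists_lipschitzOnWith_flowCoeff a n)
        (exists_lipschitzOnWith_pow hv.lipschitz (n + 1))
    refine norm_sub_le_of_lipschitz circ_pos.le hK ?_
    have hall : ∀ᵐ x, ∀ n, HasDerivAt (flowCoeff a n) (-flowRate a n x) x :=
      ae_all_iff.mpr (ae_hasDerivAt_flowCoeff a)
    filter_upwards [(ae_restrict_iff' measurableSet_Icc).mp hv.ode, hall] with x hode hV hx
    obtain ⟨s, hs, hs'⟩ := hode hx
    have hvx := (hlt x hx).le
    have hsf : s = field a x (v x) := hs.unique (hasSum_field hl hlρ' ha hvx x)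
    refine ⟨_, HasDerivAt.fun_sum fun n _ => (hV n).mul (hs'.pow (n + 1)), ?_⟩
    have e := truncated_derivative (fun j => a j.succPNat x) (fun n => flowCoeff a n x) (v x) s N
    have e2 : (∑ n ∈ Finset.range (N + 1), (-flowRate a n x * (v x) ^ (n + 1) +
        flowCoeff a n x * (((n + 1 : ℕ) : ℂ) * v x ^ (n + 1 - 1) * s))) =
        ∑ m ∈ Finset.range (N + 1), (m + 1) * flowCoeff a m x * v x ^ m *
        (s - ∑ j ∈ Finset.range (N - m), a j.succPNat x * v x ^ (j + 2)) := by
      rw [← e]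
      refine Finset.sum_congr rfl fun n _ => ?_
      simp only [flowRate, Nat.add_sub_cancel]
      push_cast
      rfl
    refine (le_of_eq (congrArg norm e2)).trans ?_
    -- The coefficient contributes 50^{-m} and the tail of the field 50^{-(N-m)}, so all N + 1 terms
    -- have the same geometric size.
    have h1 : ∀ m ∈ Finset.range (N + 1), ‖(m + 1) * flowCoeff a m x * v x ^ m *
        (s - ∑ j ∈ Finset.range (N - m), a j.succPNat x * v x ^ (j + 2))‖ ≤
        (N + 1) * (ρ * (1 / 50) ^ N) := by
      intro m hm
      have hm : m ≤ N := Nat.lt_succ_iff.mp (Finset.mem_range.mp hm)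
      rw [mul_assoc ((m : ℂ) + 1), norm_mul, norm_mul, hsf]
      have e1 : ‖(m : ℂ) + 1‖ = m + 1 := by exact_mod_cast Complex.norm_natCast (m + 1)
      calc ‖(m : ℂ) + 1‖ * ‖flowCoeff a m x * v x ^ m‖ *
            ‖field a x (v x) - ∑ j ∈ Finset.range (N - m), a j.succPNat x * v x ^ (j + 2)‖
          ≤ (N + 1) * (1 / 50) ^ m * (ρ * (1 / 50) ^ (N - m)) := by
            rw [e1]
            gcongr
            · exact norm_flowCoeff_mul_pow_le hl hlρ ha hvx hx m
            · exact norm_field_tail_le hl hlρ' ha hvx x _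
        _ = (N + 1) * (ρ * ((1 / 50) ^ m * (1 / 50) ^ (N - m))) := by ring
        _ = _ := by rw [← pow_add, Nat.add_sub_cancel' hm]
    refine (norm_sum_le_of_le _ h1).trans (le_of_eq ?_)
    rw [Finset.sum_const, Finset.card_range, nsmul_eq_mul]
    push_cast
    ring
  have htend : Tendsto (fun N : ℕ => ρ * ((N : ℝ) + 1) ^ 2 * (1 / 50) ^ N * (circ - 0)) atTop
      (𝓝 0) := by
    have h1 := (tendsto_pow_const_mul_const_pow_of_lt_one 2 (r := (1 / 50 : ℝ)) (by norm_num)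
      (by norm_num)).comp (tendsto_add_atTop_nat 1)
    have h2 := h1.const_mul (50 * ρ * circ)
    rw [mul_zero] at h2
    refine h2.congr fun N => ?_
    simp only [Function.comp]
    push_cast
    ring
  have hsum : Summable fun n => flowCoeff a n 0 * v 0 ^ (n + 1) := by
    refine Summable.of_norm_bounded ((summable_geometric_of_lt_one (r := (1 / 50 : ℝ)) (by norm_num)
      (by norm_num)).mul_left ρ) fun n => ?_
    rw [pow_succ, ← mul_assoc, norm_mul, mul_comm ρ]
    have := (hlt 0 hzero).le
    gcongr
    exact norm_flowCoeff_mul_pow_le hl hlρ ha this hzero n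
  have hlim : Tendsto (fun N => G N 0) atTop (𝓝 (v circ)) := by
    rw [tendsto_iff_norm_sub_tendsto_zero]
    refine squeeze_zero (fun _ => norm_nonneg _) (fun N => ?_) htend
    rw [norm_sub_rev, ← hGc N]
    exact hbound N
  have hlim2 := (hsum.hasSum.tendsto_sum_nat).comp (tendsto_add_atTop_nat 1)
  have : (∑' n, flowCoeff a n 0 * v 0 ^ (n + 1)) = v circ := tendsto_nhds_unique hlim2 hlim
  rw [← this]
  exact hsum.hasSum

/-- The power series of the first return map. -/
def returnSeries (a : CoeffSeq) : PowerSeries ℂ :=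
  PowerSeries.X * PowerSeries.mk fun n => flowCoeff a n 0

lemma hasSum_returnSeries_iff (a : CoeffSeq) (r w : ℂ) :
    HasSum (fun n => PowerSeries.coeff n (returnSeries a) * r ^ n) w ↔
      HasSum (fun n => flowCoeff a n 0 * r ^ (n + 1)) w := by
  rw [hasSum_nat_add_iff' 1 |>.symm]
  simp [returnSeries]

/-- A radius adapted to a sequence of coefficients. -/
lemma CoeffSeq.exists_radius (a : CoeffSeq) : ∃ l ρ : ℝ, 0 < l ∧ 0 < ρ ∧
    l * ρ * Real.exp circ ≤ 1 / 100 ∧ l * ρ ≤ 1 / 100 ∧ ∀ i x, ‖a i x‖ ≤ l ^ (i : ℕ) := by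
  obtain ⟨l, hl, ha⟩ := a.bound'
  have he := Real.one_le_exp circ_pos.le
  have he' := Real.exp_pos circ
  refine ⟨l, 1 / (100 * l * Real.exp circ), hl, by positivity, le_of_eq (by field_simp), ?_, ha⟩
  rw [mul_one_div, div_le_div_iff₀ (by positivity) (by norm_num)]
  nlinarith

lemma eventually_norm_le {ρ : ℝ} (hρ : 0 < ρ) : ∀ᶠ r in 𝓝 (0 : ℂ), ‖r‖ ≤ ρ := by
  filter_upwards [Metric.ball_mem_nhds (0 : ℂ) hρ] with z hz
  exact (mem_ball_zero_iff.mp hz).le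

/-- The first return map, as an element of `G_c[[r]]`. -/
def returnMap (a : CoeffSeq) : Gc where
  series := returnSeries a
  coeff_zero' := by simp [returnSeries]
  coeff_one' := by
    rw [returnSeries, ← zero_add 1, PowerSeries.coeff_succ_X_mul, PowerSeries.coeff_mk,
      flowCoeff_zero]
  convergent' := by
    -- Convergence at r is read off from a solution starting at r, whose end value is the sum.
    obtain ⟨l, ρ, hl, hρ, h1, h2, ha⟩ := a.exists_radius
    filter_upwards [eventually_norm_le (half_pos hρ)] with r hr
    obtain ⟨v, hv, rfl⟩ := exists_isLipschitzSolution hl hρ h2 ha hr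
    exact ((hasSum_returnSeries_iff a _ _).mpr (hv.hasSum_flowCoeff hl hρ h1 ha hr)).summable

lemma isFirstReturnMap_returnMap (a : CoeffSeq) : IsFirstReturnMap a (returnMap a) := by
  obtain ⟨l, ρ, hl, hρ, h1, h2, ha⟩ := a.exists_radius
  filter_upwards [eventually_norm_le (half_pos hρ)] with r hr
  refine ⟨exists_isLipschitzSolution hl hρ h2 ha hr, fun v hv hv0 => ?_⟩
  subst hv0
  exact (hasSum_returnSeries_iff a _ _).mpr (hv.hasSum_flowCoeff hl hρ h1 ha hr)

lemma d_returnMap (a : CoeffSeq) (n : ℕ+) : Gc.d n (returnMap a) = returnCoeff n a := by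
  have h : PowerSeries.coeff ((n : ℕ) + 1) (returnSeries a) = flowCoeff a n 0 := by
    rw [returnSeries, PowerSeries.coeff_succ_X_mul, PowerSeries.coeff_mk]
  exact h.trans (flowCoeff_eq_returnCoeff a n)

lemma returnMap_congr {a b : CoeffSeq} (h : basicInt a = basicInt b) :
    returnMap a = returnMap b := by
  have : ∀ n, flowCoeff a n 0 = flowCoeff b n 0 := fun n =>
    Finset.sum_congr rfl fun c _ => congrArg _ (congrFun h (pnatBlocks c))
  ext1
  simp only [returnMap, returnSeries, this]

/-! ### The first return map of a product -/

lemma psum_zero {p : PowerSeries ℂ} (hp : PowerSeries.constantCoeff p = 0) : psum p 0 = 0 := by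
  rw [psum, tsum_eq_single 0 (fun n hn => by simp [hn])]
  simpa using hp

lemma tendsto_psum {p : PowerSeries ℂ} (h : IsConvergent p)
    (hp : PowerSeries.constantCoeff p = 0) : Tendsto (psum p) (𝓝 0) (𝓝 0) := by
  have := (hasFPowerSeriesAt_psum h).continuousAt.tendsto
  rwa [psum_zero hp] at this

lemma Gc.ext_of_eventually {f g : Gc} (h : ∀ᶠ r in 𝓝 (0 : ℂ), ∃ w,
    HasSum (fun n => PowerSeries.coeff n f.series * r ^ n) w ∧
    HasSum (fun n => PowerSeries.coeff n g.series * r ^ n) w) : f = g := by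
  refine Gc.ext (eq_of_psum_eventuallyEq f.convergent' g.convergent' ?_)
  filter_upwards [h] with r ⟨w, hw, hw'⟩
  exact hw.tsum_eq.trans hw'.tsum_eq.symm

lemma ae_comp_half_add (d : ℝ) {p : ℝ → Prop} (h : ∀ᵐ x, p x) : ∀ᵐ t : ℝ, p (1 / 2 * t + d) := by
  have h1 : ∀ᵐ x : ℝ, p (x + d) := (measurePreserving_add_right volume d).quasiMeasurePreserving.ae h
  have h2 : Measure.QuasiMeasurePreserving (fun t : ℝ => 1 / 2 * t) volume volume :=
    ⟨by fun_prop, by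
      have e := Real.map_volume_mul_left (a := 1 / 2) (by norm_num)
      rw [e]
      exact Measure.smul_absolutelyContinuous⟩
  exact h2.ae h1

/-- With d = 0 and d = π this extracts the two halves of a solution for a product. The coefficients
are compared on the open interval only, since `concat` follows half-open intervals and assigns the
left endpoint to the other piece. -/
lemma IsLipschitzSolution.comp_half_add {a b : CoeffSeq} {v : ℝ → ℂ}
    (hv : IsLipschitzSolution a v) {d : ℝ} (hd : 0 ≤ d) (hd' : d ≤ Real.pi)
    (hab : ∀ i, ∀ t ∈ Set.Ioo 0 circ, a i (1 / 2 * t + d) = 2 * b i t) :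
    IsLipschitzSolution b fun t => v (1 / 2 * t + d) := by
  have hmaps : ∀ t ∈ Set.Icc 0 circ, 1 / 2 * t + d ∈ Set.Icc 0 circ := by
    intro t ht
    have h1 := ht.1
    have h2 := ht.2
    unfold circ at h2 ⊢
    constructor <;> linarith
  constructor
  · obtain ⟨K, hK⟩ := hv.lipschitz
    refine ⟨K, LipschitzOnWith.of_dist_le_mul fun s hs t ht => ?_⟩
    refine (hK.dist_le_mul _ (hmaps s hs) _ (hmaps t ht)).trans ?_
    gcongr
    rw [Real.dist_eq, Real.dist_eq, add_sub_add_right_eq_sub, ← mul_sub, abs_mul,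
      abs_of_pos (by norm_num)]
    have := abs_nonneg (s - t)
    linarith
  · rw [ae_restrict_iff' measurableSet_Icc]
    have hne : ∀ᵐ t : ℝ, t ≠ 0 := by simp [ae_iff, measure_singleton]
    have hne' : ∀ᵐ t : ℝ, t ≠ circ := by simp [ae_iff, measure_singleton]
    filter_upwards [ae_comp_half_add d ((ae_restrict_iff' measurableSet_Icc).mp hv.ode), hne, hne']
      with t ht h0 hc hmem
    obtain ⟨s, hs, hs'⟩ := ht (hmaps t hmem)
    refine ⟨(1 / 2 : ℝ) • s, ?_, ?_⟩
    · have h1 := hs.const_smul (1 / 2 : ℝ)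
      refine h1.congr_fun fun i => ?_
      rw [hab i t ⟨lt_of_le_of_ne hmem.1 (Ne.symm h0), lt_of_le_of_ne hmem.2 hc⟩,
        Complex.real_smul]
      push_cast
      ring
    · have h1 : HasDerivAt (fun t : ℝ => 1 / 2 * t + d) (1 / 2) t := by
        simpa using ((hasDerivAt_id t).const_mul (1 / 2 : ℝ)).add_const d
      exact hs'.scomp t h1

/-- The midpoint value of a solution for a * b is P(a)(r), and it is the initial value of the second
half; the end value is thus P(b)(P(a)(r)), which `subst_main` identifies with the sum of the
substituted series. -/
lemma returnMap_mul (a b : CoeffSeq) : returnMap (a * b) = returnMap a * returnMap b := by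
  have hpi := Real.pi_pos
  obtain ⟨ρ, hρ, -, hsub⟩ := subst_main (returnMap b).series (returnMap a).series
    (returnMap a).constantCoeff_eq (returnMap b).convergent' (returnMap a).convergent'
  refine Gc.ext_of_eventually ?_
  filter_upwards [isFirstReturnMap_returnMap (a * b), isFirstReturnMap_returnMap a,
    (tendsto_psum (returnMap a).convergent' (returnMap a).constantCoeff_eq).eventually
      (isFirstReturnMap_returnMap b), eventually_norm_le hρ] with r hab ha hb hr
  obtain ⟨v, hv, hv0⟩ := hab.1
  have hu : IsLipschitzSolution a fun t => v (1 / 2 * t + 0) := by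
    refine hv.comp_half_add le_rfl hpi.le fun i t ht => ?_
    have h1 : 0 < 1 / 2 * t + 0 := by linarith [ht.1]
    have h2 : 1 / 2 * t + 0 ≤ Real.pi := by have := ht.2; unfold circ at this; linarith
    rw [CoeffSeq.mul_apply, CoeffSeq.concat,
      toIocMod_eq_self_of_mem h1 (h2.trans (by unfold circ; linarith)), if_pos h2]
    congr 2
    ring
  have hw : IsLipschitzSolution b fun t => v (1 / 2 * t + Real.pi) := by
    refine hv.comp_half_add hpi.le le_rfl fun i t ht => ?_
    have h1 : Real.pi < 1 / 2 * t + Real.pi := by linarith [ht.1]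
    have h2 : 1 / 2 * t + Real.pi ≤ circ := by have := ht.2; unfold circ at this ⊢; linarith
    rw [CoeffSeq.mul_apply, CoeffSeq.concat, toIocMod_eq_self_of_mem (hpi.trans h1) h2,
      if_neg (not_le.mpr h1)]
    congr 2
    unfold circ
    ring
  have e1 := (ha.2 _ hu (by simp [hv0])).tsum_eq
  have e2 := (hb.2 _ hw (by
    rw [psum, e1]
    congr 1
    unfold circ
    ring)).tsum_eq
  refine ⟨v circ, hab.2 v hv hv0, ?_⟩
  have e3 := hsub r hr
  have e4 : (1 / 2 * circ + Real.pi) = circ := by unfold circ; ring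
  simp only [e4] at e2
  rw [← e2]
  exact e3

/-! ### Every convergent series is a first return map -/

/-- The series `r f'(r) - f(r)`. -/
def eulerSeries (f : PowerSeries ℂ) : PowerSeries ℂ :=
  PowerSeries.mk fun n => ((n : ℂ) - 1) * PowerSeries.coeff n f

/-- The series `f(r) / r`, for a series `f` without constant term. -/
def shiftSeries (f : PowerSeries ℂ) : PowerSeries ℂ :=
  PowerSeries.mk fun n => PowerSeries.coeff (n + 1) f

lemma isConvergent_shiftSeries {f : PowerSeries ℂ} (hf : IsConvergent f) :
    IsConvergent (shiftSeries f) := by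
  obtain ⟨ρ, hρ, h⟩ := (isConvergent_iff f).mp hf
  refine (isConvergent_iff _).mpr ⟨ρ, hρ, ?_⟩
  have h1 := ((summable_nat_add_iff 1).mpr h).mul_left ρ⁻¹
  refine h1.congr fun n => ?_
  rw [shiftSeries, PowerSeries.coeff_mk, pow_succ]
  field_simp

/-- This is z f' - f = z² (f/z)', with f/z represented by `shiftSeries`, so that nothing is divided
by z. -/
lemma hasSum_eulerSeries {f : PowerSeries ℂ} (hf0 : PowerSeries.constantCoeff f = 0)
    (hf : IsConvergent f) : ∀ᶠ z in 𝓝 (0 : ℂ),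
      DifferentiableAt ℂ (psum (shiftSeries f)) z ∧
      HasSum (fun n => PowerSeries.coeff n (eulerSeries f) * z ^ n)
        (z ^ 2 * deriv (psum (shiftSeries f)) z) := by
  obtain ⟨ρ, hρ, h⟩ := (isConvergent_iff _).mp (isConvergent_shiftSeries hf)
  set F : ℕ → ℂ → ℂ := fun n z => PowerSeries.coeff n (shiftSeries f) * z ^ n with hF
  have hd : ∀ n, DifferentiableOn ℂ (F n) (Metric.ball 0 ρ) := fun n => by fun_prop
  have hle : ∀ n, ∀ w ∈ Metric.ball (0 : ℂ) ρ,
      ‖F n w‖ ≤ ‖PowerSeries.coeff n (shiftSeries f)‖ * ρ ^ n := fun n w hw => by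
    rw [hF, norm_mul, norm_pow]
    gcongr
    exact (mem_ball_zero_iff.mp hw).le
  filter_upwards [Metric.ball_mem_nhds (0 : ℂ) hρ] with z hz
  have hdiff := Complex.differentiableOn_tsum_of_summable_norm h hd Metric.isOpen_ball hle
  have hsum := Complex.hasSum_deriv_of_summable_norm h hd Metric.isOpen_ball hle hz
  refine ⟨hdiff.differentiableAt (Metric.isOpen_ball.mem_nhds hz), ?_⟩
  have h2 := hsum.mul_left (z ^ 2)
  rw [← hasSum_nat_add_iff' 1]
  simp only [Finset.range_one, Finset.sum_singleton, eulerSeries, PowerSeries.coeff_mk,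
    PowerSeries.coeff_zero_eq_constantCoeff_apply, hf0, mul_zero, zero_mul, sub_zero]
  refine h2.congr_fun fun n => ?_
  have hdn : deriv (F n) z = PowerSeries.coeff (n + 1) f * (n * z ^ (n - 1)) := by
    simp [hF, shiftSeries]
  rw [hdn]
  cases n with
  | zero => simp
  | succ n =>
    push_cast
    ring

lemma isConvergent_eulerSeries {f : PowerSeries ℂ} (hf0 : PowerSeries.constantCoeff f = 0)
    (hf : IsConvergent f) : IsConvergent (eulerSeries f) :=
  (hasSum_eulerSeries hf0 hf).mono fun _ hz => hz.2.summable

lemma psum_eq_mul_psum_shiftSeries {f : PowerSeries ℂ} (hf0 : PowerSeries.constantCoeff f = 0)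
    (hf : IsConvergent f) : ∀ᶠ z in 𝓝 (0 : ℂ), psum f z = z * psum (shiftSeries f) z := by
  filter_upwards [isConvergent_shiftSeries hf] with z hz
  have h := hz.hasSum.mul_left z
  refine HasSum.tsum_eq ?_
  rw [← hasSum_nat_add_iff' 1]
  simp only [Finset.range_one, Finset.sum_singleton,
    PowerSeries.coeff_zero_eq_constantCoeff_apply, hf0, zero_mul, sub_zero]
  refine h.congr_fun fun n => ?_
  rw [shiftSeries, PowerSeries.coeff_mk]
  ring

/-- The generating series of the coefficients of an equation with first return map `f`: it is
`(r f' - f) ∘ f⁻¹`. -/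
def generatingSeries (f : Gc) : PowerSeries ℂ := (eulerSeries f.series).subst f⁻¹.series

lemma isConvergent_generatingSeries (f : Gc) : IsConvergent (generatingSeries f) :=
  isConvergent_subst f⁻¹.constantCoeff_eq
    (isConvergent_eulerSeries f.constantCoeff_eq f.convergent') f⁻¹.convergent'

lemma generatingSeries_subst (f : Gc) :
    (generatingSeries f).subst f.series = eulerSeries f.series := by
  have h : f⁻¹.series.subst f.series = PowerSeries.X := congrArg Gc.series (mul_inv_cancel f)
  rw [generatingSeries, PowerSeries.subst_comp_subst_apply f⁻¹.hasSubst f.hasSubst, h,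
    PowerSeries.X_subst]

/-- The coefficients (n - 1) f_n vanish for n < 2, and substituting a series without constant term
preserves order at least 2. Hence the equation has no terms of degree 0 or 1 in v. -/
lemma coeff_generatingSeries_of_lt (f : Gc) {n : ℕ} (hn : n < 2) :
    PowerSeries.coeff n (generatingSeries f) = 0 := by
  rw [generatingSeries, PowerSeries.coeff_subst' f⁻¹.hasSubst]
  refine finsum_eq_zero_of_forall_eq_zero fun k => ?_
  rcases Nat.lt_or_ge k 2 with hk | hk
  · have : PowerSeries.coeff k (eulerSeries f.series) = 0 := by
      rw [eulerSeries, PowerSeries.coeff_mk]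
      interval_cases k <;> simp [f.constantCoeff_eq]
    rw [this, zero_smul]
  · have : PowerSeries.coeff n (f⁻¹.series ^ k) = 0 := by
      apply PowerSeries.coeff_of_lt_order
      exact lt_of_lt_of_le (by exact_mod_cast hn.trans_le hk)
        (PowerSeries.le_order_pow_of_constantCoeff_eq_zero k f⁻¹.constantCoeff_eq)
    rw [this, smul_zero]

/-- The identity Q(f(z)) = E(z) as an equality of sums, indexed as in the right-hand side of the
equation. -/
lemma hasSum_generatingSeries (f : Gc) : ∀ᶠ z in 𝓝 (0 : ℂ),
    HasSum (fun i : ℕ+ => PowerSeries.coeff ((i : ℕ) + 1) (generatingSeries f) *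
      psum f.series z ^ ((i : ℕ) + 1)) (z ^ 2 * deriv (psum (shiftSeries f.series)) z) := by
  obtain ⟨ρ, hρ, -, hsub⟩ := subst_main (generatingSeries f) f.series f.constantCoeff_eq
    (isConvergent_generatingSeries f) f.convergent'
  filter_upwards [eventually_norm_le hρ, hasSum_eulerSeries f.constantCoeff_eq f.convergent',
    (tendsto_psum f.convergent' f.constantCoeff_eq).eventually (isConvergent_generatingSeries f)]
    with z hz hE hQ
  have h1 := hsub z hz
  rw [generatingSeries_subst] at h1
  have h2 : HasSum (fun n => PowerSeries.coeff n (generatingSeries f) * psum f.series z ^ n)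
      (z ^ 2 * deriv (psum (shiftSeries f.series)) z) := by
    rw [hE.2.unique h1]
    exact hQ.hasSum
  rw [← hasSum_nat_add_iff' 2] at h2
  simp only [Finset.sum_range_succ, Finset.range_zero, Finset.sum_empty,
    coeff_generatingSeries_of_lt f one_lt_two, coeff_generatingSeries_of_lt f zero_lt_two, zero_mul,
    add_zero, sub_zero] at h2
  rw [← Equiv.pnatEquivNat.symm.hasSum_iff]
  exact h2

/-- An equation with first return map `f`. -/
def coeffSeqOf (f : Gc) : CoeffSeq where
  toFun i x := (circ : ℂ)⁻¹ * PowerSeries.coeff ((i : ℕ) + 1) (generatingSeries f) *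
    ((toIocMod circ_pos 0 x / circ : ℝ) : ℂ) ^ ((i : ℕ) - 1)
  measurable' i := by
    have := CoeffSeq.measurable_toIocMod
    fun_prop
  periodic' i x := by simp [toIocMod_add_right]
  bound' := by
    obtain ⟨ρ, hρ, h⟩ := (isConvergent_iff _).mp (isConvergent_generatingSeries f)
    obtain ⟨C, hC⟩ := h.tendsto_atTop_zero.bddAbove_range
    -- Convergence gives |q_{i+1}| ≤ (C/ρ) ρ^{-i}. The constant C/ρ is absorbed into D^i, as D ≥ 1
    -- and i ≥ 1.
    set D : ℝ := max 1 (C / ρ) with hD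
    have hD1 : 1 ≤ D := le_max_left _ _
    refine ⟨D / ρ, by positivity, fun i x => ?_⟩
    have hx := toIocMod_mem_Ioc circ_pos 0 x
    have ht0 : 0 ≤ toIocMod circ_pos 0 x / circ := div_nonneg hx.1.le circ_pos.le
    have ht1 : toIocMod circ_pos 0 x / circ ≤ 1 := by
      rw [div_le_one circ_pos]
      simpa using hx.2
    have hq : ‖PowerSeries.coeff ((i : ℕ) + 1) (generatingSeries f)‖ * ρ ^ ((i : ℕ) + 1) ≤ C :=
      hC ⟨_, rfl⟩
    have hc : ‖(circ : ℂ)⁻¹‖ ≤ 1 := by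
      rw [norm_inv, Complex.norm_real, Real.norm_of_nonneg circ_pos.le]
      refine inv_le_one_of_one_le₀ ?_
      have := Real.pi_gt_three
      unfold circ
      linarith
    rw [norm_mul, norm_mul, norm_pow, Complex.norm_real, Real.norm_of_nonneg ht0]
    calc ‖(circ : ℂ)⁻¹‖ * ‖PowerSeries.coeff ((i : ℕ) + 1) (generatingSeries f)‖ *
          (toIocMod circ_pos 0 x / circ) ^ ((i : ℕ) - 1)
        ≤ 1 * ‖PowerSeries.coeff ((i : ℕ) + 1) (generatingSeries f)‖ * 1 := by
          gcongr
          exact pow_le_one₀ ht0 ht1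
      _ ≤ (C / ρ) / ρ ^ (i : ℕ) := by
          rw [one_mul, mul_one, div_div, le_div_iff₀ (by positivity), ← pow_succ']
          exact hq
      _ ≤ D ^ (i : ℕ) / ρ ^ (i : ℕ) := by
          gcongr
          exact (le_max_right _ _).trans (le_self_pow₀ hD1 i.ne_zero)
      _ = (D / ρ) ^ (i : ℕ) := (div_pow _ _ _).symm

/-- The interpolation f(tr)/t, with t = x/2π, written as r h(tr) for h(z) = f(z)/z so that it makes
sense at t = 0. -/
lemma isLipschitzSolution_coeffSeqOf (f : Gc) : ∀ᶠ r in 𝓝 (0 : ℂ),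
    IsLipschitzSolution (coeffSeqOf f)
      fun x => r * psum (shiftSeries f.series) (((x / circ : ℝ) : ℂ) * r) := by
  have hconv := isConvergent_shiftSeries f.convergent'
  obtain ⟨K, s, hs, hK⟩ := (hasFPowerSeriesAt_psum hconv).hasStrictDerivAt.hasStrictFDerivAt
    |>.exists_lipschitzOnWith
  obtain ⟨ε, hε, hball⟩ := Metric.mem_nhds_iff.mp (Filter.inter_mem hs
    ((hasSum_generatingSeries f).and ((psum_eq_mul_psum_shiftSeries f.constantCoeff_eq f.convergent').and
      (hasSum_eulerSeries f.constantCoeff_eq f.convergent'))))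
  filter_upwards [Metric.ball_mem_nhds (0 : ℂ) hε] with r hr
  have hmem : ∀ x ∈ Set.Icc 0 circ, ((x / circ : ℝ) : ℂ) * r ∈ Metric.ball (0 : ℂ) ε := by
    intro x hx
    rw [mem_ball_zero_iff] at hr ⊢
    rw [norm_mul, Complex.norm_real, Real.norm_of_nonneg (div_nonneg hx.1 circ_pos.le)]
    refine lt_of_le_of_lt (mul_le_of_le_one_left (norm_nonneg r) ?_) hr
    rw [div_le_one circ_pos]
    exact hx.2
  constructor
  · refine ⟨‖r‖₊ * (K * (‖r‖₊ * (circ⁻¹).toNNReal)), LipschitzOnWith.of_dist_le_mul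
      fun x hx y hy => ?_⟩
    have h1 := hK.dist_le_mul _ (hball (hmem x hx)).1 _ (hball (hmem y hy)).1
    rw [dist_eq_norm, ← mul_sub, norm_mul, ← dist_eq_norm]
    rw [NNReal.coe_mul, NNReal.coe_mul, NNReal.coe_mul, coe_nnnorm,
      Real.coe_toNNReal _ (inv_nonneg.mpr circ_pos.le)]
    have h2 : dist (((x / circ : ℝ) : ℂ) * r) (((y / circ : ℝ) : ℂ) * r) =
        ‖r‖ * circ⁻¹ * dist x y := by
      rw [dist_eq_norm, ← sub_mul, norm_mul, ← Complex.ofReal_sub, Complex.norm_real, ← sub_div,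
        norm_div, Real.norm_of_nonneg circ_pos.le, Real.dist_eq, Real.norm_eq_abs]
      ring
    rw [h2] at h1
    refine (mul_le_mul_of_nonneg_left h1 (norm_nonneg r)).trans (le_of_eq ?_)
    ring
  · rw [ae_restrict_iff' measurableSet_Icc]
    -- At x = 0 the division by t² fails, and `toIocMod` takes the value 2π there instead of 0.
    have hne : ∀ᵐ t : ℝ, t ≠ 0 := by simp [ae_iff, measure_singleton]
    filter_upwards [hne] with x hx0 hx
    have hxpos : 0 < x := lt_of_le_of_ne hx.1 (Ne.symm hx0)
    set t : ℂ := ((x / circ : ℝ) : ℂ) with ht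
    have ht0 : t ≠ 0 := Complex.ofReal_ne_zero.mpr (div_pos hxpos circ_pos).ne'
    obtain ⟨-, hgen, hps, hdiff, -⟩ := hball (hmem x hx)
    rw [← ht] at hgen hps hdiff
    refine ⟨r * (deriv (psum (shiftSeries f.series)) (t * r) * ((circ : ℂ)⁻¹ * r)), ?_, ?_⟩
    · have h1 := hgen.mul_left ((circ : ℂ)⁻¹ * (t ^ 2)⁻¹)
      convert! h1 using 1
      · funext i
        have e : (coeffSeqOf f) i x = (circ : ℂ)⁻¹ *
            PowerSeries.coeff ((i : ℕ) + 1) (generatingSeries f) * t ^ ((i : ℕ) - 1) := by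
          change (circ : ℂ)⁻¹ * PowerSeries.coeff ((i : ℕ) + 1) (generatingSeries f) *
            ((toIocMod circ_pos 0 x / circ : ℝ) : ℂ) ^ ((i : ℕ) - 1) = _
          rw [toIocMod_eq_self_of_mem hxpos hx.2]
        have e2 : t ^ ((i : ℕ) + 1) = t ^ ((i : ℕ) - 1) * t ^ 2 := by
          rw [← pow_add]; congr 1; have := i.pos; omega
        rw [e, hps, mul_assoc t r, mul_pow t, e2]
        field_simp
      · field_simp
    · have h1 : HasDerivAt (fun y : ℝ => ((y / circ : ℝ) : ℂ) * r) ((circ : ℂ)⁻¹ * r) x := by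
        have := (((hasDerivAt_id x).div_const circ).ofReal_comp).mul_const r
        simpa using this
      have h2 : HasDerivAt (psum (shiftSeries f.series))
        (deriv (psum (shiftSeries f.series)) (t * r)) (t * r) := hdiff.hasDerivAt
      exact (h2.comp x h1).const_mul r

lemma returnMap_surjective : Function.Surjective returnMap := by
  intro f
  refine ⟨coeffSeqOf f, Gc.ext_of_eventually ?_⟩
  filter_upwards [isFirstReturnMap_returnMap (coeffSeqOf f), isLipschitzSolution_coeffSeqOf f,
    psum_eq_mul_psum_shiftSeries f.constantCoeff_eq f.convergent', f.convergent']
    with r hret hsol hps hf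
  refine ⟨psum f.series r, ?_, hf.hasSum⟩
  have h0 : psum (shiftSeries f.series) 0 = 1 := by
    rw [psum, tsum_eq_single 0 (fun n hn => by simp [hn]), shiftSeries, PowerSeries.coeff_mk,
      f.coeff_one']
    simp
  have h1 := hret.2 _ hsol (by simp [h0])
  rw [div_self circ_pos.ne', Complex.ofReal_one, one_mul, ← hps] at h1
  exact h1

/-! ### The topological group `G_c[[r]]` -/

namespace Gc

lemma continuous_d (k : ℕ+) : Continuous (d k) :=
  continuous_iff_le_induced.mpr (iInf_le _ k)

lemma continuous_coeff (n : ℕ) : Continuous fun f : Gc => PowerSeries.coeff n f.series := by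
  match n with
  | 0 => simpa only [coeff_zero'] using continuous_const
  | 1 => simpa only [coeff_one'] using continuous_const
  | n + 2 => exact continuous_d n.succPNat

lemma continuous_coeff_pow (n k : ℕ) :
    Continuous fun f : Gc => PowerSeries.coeff n (f.series ^ k) := by
  induction k generalizing n with
  | zero => simpa only [pow_zero] using continuous_const
  | succ k ih =>
    simp only [pow_succ, PowerSeries.coeff_mul]
    exact continuous_finsetSum _ fun x _ => (ih x.1).mul (continuous_coeff x.2)

lemma continuous_iff_coeff {Y : Type*} [TopologicalSpace Y] {F : Y → Gc}
    (h : ∀ n, Continuous fun y => PowerSeries.coeff n (F y).series) : Continuous F :=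
  continuous_iInf_rng.mpr fun _ => continuous_induced_rng.mpr (h _)

lemma coeff_pow_of_lt (f : Gc) {n k : ℕ} (h : n < k) : PowerSeries.coeff n (f.series ^ k) = 0 := by
  apply PowerSeries.coeff_of_lt_order
  exact lt_of_lt_of_le (by exact_mod_cast h)
    (PowerSeries.le_order_pow_of_constantCoeff_eq_zero k f.constantCoeff_eq)

lemma coeff_pow_self (f : Gc) (n : ℕ) : PowerSeries.coeff n (f.series ^ n) = 1 := by
  induction n with
  | zero => simp
  | succ n ih =>
    rw [pow_succ, PowerSeries.coeff_mul, Finset.sum_eq_single (n, 1), ih, f.coeff_one', one_mul]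
    · rintro ⟨i, j⟩ hij hne
      have hij : i + j = n + 1 := by simpa using hij
      rcases lt_trichotomy j 1 with hj | hj | hj
      · obtain rfl : j = 0 := by omega
        simp [f.constantCoeff_eq]
      · exact absurd (by ext <;> simp <;> omega) hne
      · rw [f.coeff_pow_of_lt (by omega), zero_mul]
    · simp

/-- The k-th power of f has order at least k, so the substitution sum stops at k = n; multiplication
is thus polynomial in each coefficient. -/
lemma coeff_mul (f g : Gc) (n : ℕ) : PowerSeries.coeff n (f * g).series =
    ∑ k ∈ Finset.range (n + 1),
      PowerSeries.coeff k g.series * PowerSeries.coeff n (f.series ^ k) := by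
  rw [mul_eq_comp, comp, PowerSeries.coeff_subst' f.hasSubst]
  simp only [smul_eq_mul]
  refine finsum_eq_sum_of_support_subset _ fun k hk => ?_
  rw [Finset.coe_range, Set.mem_Iio]
  by_contra hlt
  exact hk (by simp only; rw [f.coeff_pow_of_lt (by omega), mul_zero])

/-- Comparing coefficients in f⁻¹ ∘ f = r gives a triangular system: the n-th coefficient of f⁻¹ has
factor 1, since f^n has leading coefficient 1, and the other terms involve only earlier
coefficients. -/
lemma continuous_coeff_inv (n : ℕ) : Continuous fun f : Gc => PowerSeries.coeff n f⁻¹.series := by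
  induction n using Nat.strong_induction_on with
  | _ n ih =>
  have h : ∀ f : Gc, PowerSeries.coeff n f⁻¹.series = PowerSeries.coeff n (1 : Gc).series -
      ∑ k ∈ Finset.range n,
        PowerSeries.coeff k f⁻¹.series * PowerSeries.coeff n (f.series ^ k) := by
    intro f
    have := coeff_mul f f⁻¹ n
    rw [mul_inv_cancel, Finset.sum_range_succ, coeff_pow_self, mul_one] at this
    rw [this]
    ring
  simp only [h]
  exact continuous_const.sub (continuous_finsetSum _ fun k hk =>
    (ih k (Finset.mem_range.mp hk)).mul (continuous_coeff_pow n k))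

instance : IsTopologicalGroup Gc where
  continuous_mul := by
    refine continuous_iff_coeff fun n => ?_
    simp only [coeff_mul]
    exact continuous_finsetSum _ fun k _ => ((continuous_coeff k).comp continuous_snd).mul
      ((continuous_coeff_pow n k).comp continuous_fst)
  continuous_inv := continuous_iff_coeff continuous_coeff_inv

end Gc

/-! ### The quotient Q(X) and its topology -/

/-- The homomorphism `G(X) → G_c[[r]]` induced by the first return map. -/
def returnHom : GX →* Gc :=
  MonoidHom.mk' (fun g => Quotient.lift returnMap
    (fun a b h => returnMap_congr ((equivRel_iff a b).mp h)) g) (by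
    rintro ⟨a⟩ ⟨b⟩
    exact returnMap_mul a b)

lemma returnHom_surjective : Function.Surjective returnHom := fun f => by
  obtain ⟨a, ha⟩ := returnMap_surjective f
  exact ⟨GX.mk a, ha⟩

/-- The isomorphism `Q(X) ≃ G_c[[r]]` of groups. -/
def quotientEquiv : (GX ⧸ returnHom.ker) ≃* Gc :=
  QuotientGroup.quotientKerEquivOfSurjective returnHom returnHom_surjective

/-- Pulling back commutes with infima of topologies, so the weak topology on the quotient makes the
algebraic isomorphism inducing. -/
lemma iInf_induced_comp_quotientEquiv :
    (⨅ n : ℕ+, TopologicalSpace.induced (fun q : GX ⧸ returnHom.ker => Gc.d n (quotientEquiv q))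
      inferInstance) = TopologicalSpace.induced quotientEquiv (inferInstance : TopologicalSpace Gc) := by
  change _ = TopologicalSpace.induced quotientEquiv
    (⨅ k : ℕ+, TopologicalSpace.induced (Gc.d k) inferInstance)
  rw [induced_iInf]
  simp only [induced_compose]
  rfl

end CenterProblem

end

theorem theorem3p9 :
    IsTopologicalGroup Gc ∧
    -- the homomorphism induced by the first return map
    ∃ Phat : GX →* Gc, (∀ a : CoeffSeq, IsFirstReturnMap a (Phat (GX.mk a))) ∧
    -- the induced coefficient functions on the quotient by the kernel
    ∃ cbar : ℕ+ → GX ⧸ Phat.ker → ℂ,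
      (∀ (n : ℕ+) (a : CoeffSeq), cbar n (QuotientGroup.mk' Phat.ker (GX.mk a)) = returnCoeff n a) ∧
      (∀ (n : ℕ+) (g : GX), cbar n (QuotientGroup.mk' Phat.ker g) = Gc.d n (Phat g)) ∧
      letI : TopologicalSpace (GX ⧸ Phat.ker) :=
        ⨅ n : ℕ+, TopologicalSpace.induced (cbar n) inferInstance
      IsTopologicalGroup (GX ⧸ Phat.ker) ∧
      ∃ Pbar : (GX ⧸ Phat.ker) ≃ₜ* Gc, ∀ g : GX, Phat g = Pbar (QuotientGroup.mk' Phat.ker g) := by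
  refine ⟨inferInstance, returnHom, isFirstReturnMap_returnMap,
    fun n q => Gc.d n (quotientEquiv q), fun n a => d_returnMap a n, fun n g => rfl, ?_⟩
  rw [iInf_induced_comp_quotientEquiv]
  let _ : TopologicalSpace (GX ⧸ returnHom.ker) :=
    TopologicalSpace.induced quotientEquiv (inferInstance : TopologicalSpace Gc)
  have hind : IsInducing quotientEquiv := ⟨rfl⟩
  refine ⟨topologicalGroup_induced quotientEquiv, ⟨quotientEquiv, hind.continuous, ?_⟩, fun g => rfl⟩
  -- Continuity of the inverse is tested after composing with `quotientEquiv`, which yields the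
  -- identity.
  refine hind.continuous_iff.mpr (continuous_id.congr fun f => ?_)
  exact (quotientEquiv.apply_symm_apply f).symm
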